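/- Let $\mathfrak h$ (initial space) and $\mathsf k$ (noise space) be separable complex Hilbert spaces, let $\mathcal A\subseteq B(\mathfrak h)$ be a von Neumann algebra, $\hat{\mathsf k}=\mathbb C\oplus\mathsf k$, $\hat c=(1,c)$ for $c\in\mathsf k$, and let $\mathcal F$ be the Boson Fock space over $L^2(\mathbb R_+;\mathsf k)$ with exponential vectors $\varepsilon(f)$, $\langle\varepsilon(f),\varepsilon(g)\rangle=e^{\langle f,g\rangle}$. For a vector $u$ let $E_u=|u\rangle\otimes I:\xi\mapsto u\otimes\xi$ and $E^u=(E_u)^*$; let $\Delta=P_{\mathsf k}\otimes I$, where $P_{\mathsf k}$ is the orthogonal projection of $\hat{\mathsf k}$ onto $\mathsf k$; and let $P_t$ be the orthogonal projection on $\mathfrak h\otimes\mathcal F$ with $P_t(u\otimes\varepsilon(f))=u\otimes\varepsilon(1_{[0,t)}f)$. For a family $f$ of bounded operators indexed by $[0,\infty)$, $\|f\|_{p,t}$ denotes the $L^p$ norm of $s\mapsto 1_{[0,t)}(s)\|f_s\|$. A *vacuum-adapted process in* $\mathcal A$ is a family $Z=(Z_t)_{t\ge0}$ in $\mathcal A\,\overline\otimes\,B(\mathcal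 F)$ such that $t\mapsto\langle\zeta',Z_t\zeta\rangle$ is measurable for all $\zeta,\zeta'$ and $Z_t=P_tZ_tP_t$ for all $t$. An *integrand process* is a family $G=(G_t)_{t\ge0}$ in $B(\hat{\mathsf k})\,\overline\otimes\,\mathcal A\,\overline\otimes\,B(\mathcal F)$ which is weakly measurable in the same sense, satisfies $G_t=(I\otimes P_t)G_t(I\otimes P_t)$ for all $t$, and whose block form $\begin{bmatrix}k&m\\ l&n\end{bmatrix}$ with respect to $\hat{\mathsf k}=\mathbb C\oplus\mathsf k$ satisfies $\|k\|_{1,t}+\|l\|_{2,t}+\|m\|_{2,t}+\|n\|_{\infty,t}<\infty$ for all $t\ge0$. Its quantum stochastic integral $\bigl(\int_0^tG_s\,d\Lambda_s\bigr)_{t\ge0}$ is the vacuum-adapted process in $\mathcal A$ with $$\Bigl\langle u\otimes\varepsilon(f),\int_0^tG_s\,d\Lambda_s\,v\otimes\varepsilon(g)\Bigr\rangle=\int_0^t\bigl\langle u\otimes\varepsilon(f),E^{\widehat{f(s)}}G_sE_{\widehat{g(s)}}\,v\otimes\varepsilon(g)\bigr\rangle\,ds$$ for all $u,v\in\mathfrak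 h$, $f,g\in L^2(\mathbb R_+;\mathsf k)$, $t\ge0$. **Theorem.** Let $G$ be an integrand process with $G_t\Delta=0$ for all $t\ge0$, so that its block form is $\begin{bmatrix}k&0\\ l&0\end{bmatrix}$, and let $X$ be a vacuum-adapted process in $\mathcal A$ with $\sup_{s\le t}\|X_s\|<\infty$ for all $t\ge0$. Then there is a unique vacuum-adapted process $Z$ in $\mathcal A$ such that $(G_s(I_{\hat{\mathsf k}}\otimes Z_s))_{s\ge0}$ is an integrand process and $$Z_t=X_t+\int_0^tG_s(I_{\hat{\mathsf k}}\otimes Z_s)\,d\Lambda_s\qquad(t\ge0).$$ Furthermore, $$\|Z\|_{\infty,t}\le\sqrt2\,\|X\|_{\infty,t}\exp\bigl(2\|l\|_{2,t}^2+2\|k\|_{1,t}^2\bigr)\qquad(t\ge0),$$ and $t\mapsto Z_t$ is norm continuous if and only if $t\mapsto X_t$ is norm continuous. -/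

import Mathlib

open MeasureTheory
open scoped NNReal ENNReal TensorProduct InnerProductSpace

noncomputable section

namespace VacQSDE

/-! ### Hilbert-space tensor products and von Neumann algebras -/

section Tensor

variable {E F E' F' : Type*}
  [NormedAddCommGroup E] [InnerProductSpace ℂ E]
  [NormedAddCommGroup F] [InnerProductSpace ℂ F]
  [NormedAddCommGroup E'] [InnerProductSpace ℂ E']
  [NormedAddCommGroup F'] [InnerProductSpace ℂ F']

/-- The Hilbert-space tensor product: the completion of the algebraic tensor product for the
inner product determined by `⟪x ⊗ y, x' ⊗ y'⟫ = ⟪x, x'⟫ ⟪y, y'⟫`. -/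
def HTensor (E F : Type*) [NormedAddCommGroup E] [InnerProductSpace ℂ E]
    [NormedAddCommGroup F] [InnerProductSpace ℂ F] : Type _ :=
  UniformSpace.Completion (E ⊗[ℂ] F)

instance : NormedAddCommGroup (HTensor E F) :=
  inferInstanceAs (NormedAddCommGroup (UniformSpace.Completion (E ⊗[ℂ] F)))

instance : InnerProductSpace ℂ (HTensor E F) :=
  inferInstanceAs (InnerProductSpace ℂ (UniformSpace.Completion (E ⊗[ℂ] F)))

instance : CompleteSpace (HTensor E F) :=
  inferInstanceAs (CompleteSpace (UniformSpace.Completion (E ⊗[ℂ] F)))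

/-- The canonical isometric embedding of the algebraic tensor product. -/
def ofAlg : E ⊗[ℂ] F →ₗᵢ[ℂ] HTensor E F :=
  (UniformSpace.Completion.toComplₗᵢ : E ⊗[ℂ] F →ₗᵢ[ℂ] UniformSpace.Completion (E ⊗[ℂ] F))

theorem denseRange_ofAlg : DenseRange (ofAlg : E ⊗[ℂ] F →ₗᵢ[ℂ] HTensor E F) :=
  UniformSpace.Completion.denseRange_coe (α := E ⊗[ℂ] F)

/-- The bounded operator `E_u = |u⟩ ⊗ I`, that is, `y ↦ u ⊗ y`. Its adjoint is `E^u`. -/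
def ket (F : Type*) [NormedAddCommGroup F] [InnerProductSpace ℂ F] (u : E) :
    F →L[ℂ] HTensor E F :=
  ofAlg.toContinuousLinearMap ∘L TensorProduct.mkL ℂ E F u

/-- The elementary tensor `x ⊗ y` in the Hilbert-space tensor product. -/
def tmul (x : E) (y : F) : HTensor E F := ket F x y

/-- The tensor product `S ⊗ T` of bounded operators. -/
def opTensor (S : E →L[ℂ] E') (T : F →L[ℂ] F') : HTensor E F →L[ℂ] HTensor E' F' :=
  ((TensorProduct.mapL S T).completion :
    UniformSpace.Completion (E ⊗[ℂ] F) →L[ℂ] UniformSpace.Completion (E' ⊗[ℂ] F'))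

theorem opTensor_ofAlg (S : E →L[ℂ] E') (T : F →L[ℂ] F') (z : E ⊗[ℂ] F) :
    opTensor S T (ofAlg z) = ofAlg (TensorProduct.mapL S T z) :=
  ContinuousLinearMap.completion_apply_coe (TensorProduct.mapL S T) z

theorem inner_tmul (x x' : E) (y y' : F) :
    inner ℂ (tmul x y) (tmul x' y') = inner ℂ x x' * inner ℂ y y' := by
  simp [tmul, ket, TensorProduct.mkL_apply_apply, LinearIsometry.inner_map_map]

theorem opTensor_tmul (S : E →L[ℂ] E') (T : F →L[ℂ] F') (x : E) (y : F) :
    opTensor S T (tmul x y) = tmul (S x) (T y) := by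
  simp [tmul, ket, TensorProduct.mkL_apply_apply, opTensor_ofAlg]

/-- The von Neumann algebra generated by a set `S` of bounded operators: the double commutant
of `S ∪ S*`. -/
def generatedVN {H : Type*} [NormedAddCommGroup H] [InnerProductSpace ℂ H] [CompleteSpace H]
    (S : Set (H →L[ℂ] H)) : VonNeumannAlgebra H where
  toStarSubalgebra := StarSubalgebra.centralizer ℂ (StarSubalgebra.centralizer ℂ S : Set _)
  centralizer_centralizer' := by
    simp

/-- The algebra `B(H)` of all bounded operators. -/
def fullVN (H : Type*) [NormedAddCommGroup H] [InnerProductSpace ℂ H] [CompleteSpace H] :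
    VonNeumannAlgebra H where
  toStarSubalgebra := ⊤
  centralizer_centralizer' := by
    refine Set.eq_univ_of_forall fun x => ?_
    rw [Set.mem_centralizer_iff]
    intro c hc
    exact (Set.mem_centralizer_iff.1 hc x (Set.mem_univ x)).symm

/-- The ultraweak (von Neumann algebra) tensor product: the von Neumann algebra on the
Hilbert-space tensor product generated by the elementary tensors `a ⊗ b`. -/
def tensorVN [CompleteSpace E] [CompleteSpace F]
    (M : VonNeumannAlgebra E) (N : VonNeumannAlgebra F) : VonNeumannAlgebra (HTensor E F) :=
  generatedVN {T | ∃ a ∈ M, ∃ b ∈ N, T = opTensor a b}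

end Tensor

/-! ### Boson Fock space over `L²(ℝ₊; k)` -/

/-- Lebesgue measure on `ℝ₊ = [0, ∞)`. -/
def leb : Measure ℝ≥0 := Measure.comap ((↑) : ℝ≥0 → ℝ) volume

section Fock

variable (𝔨 : Type*) [NormedAddCommGroup 𝔨] [InnerProductSpace ℂ 𝔨]

/-- The Hilbert space `L²(ℝ₊; k)`. -/
abbrev NoiseL2 : Type _ := Lp 𝔨 2 leb

/-- The exponential kernel `(f, g) ↦ exp ⟪f, g⟫`, with values in `B(ℂ)`. -/
def expKernel (V : Type*) [NormedAddCommGroup V] [InnerProductSpace ℂ V] :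
    Matrix V V (ℂ →L[ℂ] ℂ) :=
  Matrix.of fun f g => Complex.exp (inner ℂ f g) • ContinuousLinearMap.id ℂ ℂ

open scoped ComplexOrder in
theorem posSemidef_inner (V : Type*) [NormedAddCommGroup V] [InnerProductSpace ℂ V] :
    (Matrix.of fun f g : V => (inner ℂ f g : ℂ)).PosSemidef := by
  refine ⟨?_, fun x => ?_⟩
  · ext f g
    simp [Matrix.conjTranspose_apply]
  · have h : (x.sum fun i xi => x.sum fun j xj => star xi *
        (Matrix.of fun f g : V => (inner ℂ f g : ℂ)) i j * xj) =
        inner ℂ (x.sum fun i xi => xi • i) (x.sum fun i xi => xi • i) := by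
      simp only [Finsupp.sum, sum_inner, inner_smul_left, Matrix.of_apply]
      refine Finset.sum_congr rfl fun i _ => ?_
      rw [inner_sum, Finset.mul_sum]
      refine Finset.sum_congr rfl fun j _ => ?_
      simp only [RCLike.star_def, inner_smul_right]
      ring
    rw [h, inner_self_eq_norm_sq_to_K]
    simp

open scoped ComplexOrder in
theorem posSemidef_exp_inner (V : Type*) [NormedAddCommGroup V] [InnerProductSpace ℂ V] :
    (Matrix.of fun f g : V => Complex.exp (inner ℂ f g)).PosSemidef := by
  have hpow : ∀ n : ℕ, (Matrix.of fun f g : V => (inner ℂ f g : ℂ) ^ n).PosSemidef := by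
    intro n
    induction n with
    | zero =>
      refine ⟨?_, fun x => ?_⟩
      · ext f g
        simp [Matrix.conjTranspose_apply]
      · have h : (x.sum fun i xi => x.sum fun j xj => star xi *
            (Matrix.of fun f g : V => (inner ℂ f g : ℂ) ^ 0) i j * xj) =
            star (x.sum fun _ xi => xi) * (x.sum fun _ xi => xi) := by
          simp [Finsupp.sum, Finset.sum_mul_sum]
        rw [h]
        exact star_mul_self_nonneg _
    | succ n ih =>
      have h : (Matrix.of fun f g : V => (inner ℂ f g : ℂ) ^ (n + 1)) =
          (Matrix.of fun f g : V => (inner ℂ f g : ℂ) ^ n).hadamard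
            (Matrix.of fun f g : V => (inner ℂ f g : ℂ)) := by
        ext f g
        simp [Matrix.hadamard, pow_succ]
      rw [h]
      exact ih.hadamard (posSemidef_inner V)
  refine ⟨?_, fun x => ?_⟩
  · ext f g
    simp [Matrix.conjTranspose_apply, ← Complex.exp_conj]
  · have hs : HasSum (fun n : ℕ => x.sum fun i xi => x.sum fun j xj => star xi *
        ((n.factorial : ℂ)⁻¹ * (inner ℂ i j : ℂ) ^ n) * xj)
        (x.sum fun i xi => x.sum fun j xj => star xi *
        (Matrix.of fun f g : V => Complex.exp (inner ℂ f g)) i j * xj) := by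
      simp only [Finsupp.sum]
      refine hasSum_sum fun i _ => hasSum_sum fun j _ => ?_
      refine HasSum.mul_right _ (HasSum.mul_left _ ?_)
      rw [Matrix.of_apply, Complex.exp_eq_exp_ℂ]
      simpa [smul_eq_mul] using NormedSpace.exp_series_hasSum_exp' (𝕂 := ℂ) (inner ℂ i j : ℂ)
    refine hs.nonneg fun n => ?_
    have h1 := (hpow n).2 x
    have h2 : (0 : ℂ) ≤ (n.factorial : ℂ)⁻¹ := by
      rw [← Complex.ofReal_natCast, ← Complex.ofReal_inv]
      exact Complex.zero_le_real.2 (by positivity)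
    have h3 := mul_nonneg h2 h1
    convert h3 using 1
    simp only [Finsupp.sum, Finset.mul_sum, Matrix.of_apply]
    refine Finset.sum_congr rfl fun i _ => Finset.sum_congr rfl fun j _ => ?_
    ring

open scoped ComplexOrder in
instance fact_posSemidef_expKernel (V : Type*) [NormedAddCommGroup V] [InnerProductSpace ℂ V] :
    Fact (expKernel V).PosSemidef := by
  have htfae := (RKHS.posSemidef_tfae (K := expKernel V)).out 0 2
  refine ⟨htfae.2 ⟨?_, fun x => ?_⟩⟩
  · ext f g
    have h1 : star (ContinuousLinearMap.id ℂ ℂ) = ContinuousLinearMap.id ℂ ℂ :=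
      star_one (ℂ →L[ℂ] ℂ)
    simp [expKernel, Matrix.conjTranspose_apply, ← Complex.exp_conj, h1]
  · have h := (posSemidef_exp_inner V).2 x
    refine (Complex.le_def.1 h).1.trans_eq ?_
    change Complex.re _ = Complex.re _
    congr 1
    refine Finsupp.sum_congr fun i _ => Finsupp.sum_congr fun j _ => ?_
    simp [expKernel, ← Complex.exp_conj]
    ring

/-- The Boson Fock space over a Hilbert space `V`: the completed linear span of exponential
vectors `ε(f)`, `f ∈ V`, for the inner product with `⟪ε(f), ε(g)⟫ = exp ⟪f, g⟫`. -/
def FockOver (V : Type*) [NormedAddCommGroup V] [InnerProductSpace ℂ V] : Type _ :=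
  RKHS.OfKernel (expKernel V)

section FockOver

variable (V : Type*) [NormedAddCommGroup V] [InnerProductSpace ℂ V]

instance : NormedAddCommGroup (FockOver V) :=
  inferInstanceAs (NormedAddCommGroup (UniformSpace.Completion (RKHS.H₀ (expKernel V))))

instance : InnerProductSpace ℂ (FockOver V) :=
  inferInstanceAs (InnerProductSpace ℂ (UniformSpace.Completion (RKHS.H₀ (expKernel V))))

instance : CompleteSpace (FockOver V) :=
  inferInstanceAs (CompleteSpace (UniformSpace.Completion (RKHS.H₀ (expKernel V))))

instance : RKHS ℂ (FockOver V) V ℂ :=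
  inferInstanceAs (RKHS ℂ (RKHS.OfKernel (expKernel V)) V ℂ)

variable {V}

/-- The exponential vector `ε(f)`. -/
def expVec (f : V) : FockOver V := RKHS.kerFun (FockOver V) f 1

theorem inner_expVec (f g : V) : inner ℂ (expVec f) (expVec g) = Complex.exp (inner ℂ f g) := by
  have hk : RKHS.kernel (FockOver V) = expKernel V := RKHS.OfKernel.kernel_ofKernel
  rw [expVec, expVec, ← RKHS.kernel_inner, hk]
  simp [expKernel, ← Complex.exp_conj]

/-- Exponential vectors are total. -/
theorem span_expVec_dense :
    (Submodule.span ℂ (Set.range (expVec : V → FockOver V))).topologicalClosure = ⊤ := by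
  rw [eq_top_iff, ← RKHS.kerFun_dense (FockOver V)]
  refine Submodule.topologicalClosure_mono (Submodule.span_le.2 ?_)
  rintro _ ⟨f, v, rfl⟩
  have : RKHS.kerFun (FockOver V) f v = v • expVec f := by
    rw [expVec, ← map_smul, smul_eq_mul, mul_one]
  rw [this]
  exact Submodule.smul_mem _ _ (Submodule.subset_span ⟨f, rfl⟩)

end FockOver

/-- The Fock space `F` over `L²(ℝ₊; k)`. -/
abbrev Fock : Type _ := FockOver (NoiseL2 𝔨)

/-- The projection `I_{t)} ⊗ |Ω_{[t}⟩⟨Ω_{[t}|` on `F = F_{t)} ⊗ F_{[t}`: the orthogonal projection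
onto the closed linear span of the `ε(f)` with `f` supported in `[0, t)`, which is
`F_{t)} ⊗ Ω_{[t}`. It maps `ε(f)` to `ε(1_{[0,t)} f)`. -/
def fockVacProj (t : ℝ≥0) : Fock 𝔨 →L[ℂ] Fock 𝔨 :=
  (Submodule.span ℂ {x | ∃ f : NoiseL2 𝔨, (∀ᵐ s ∂leb, t ≤ s → f s = 0) ∧
    x = expVec f}).topologicalClosure.starProjection

theorem fockVacProj_expVec (t : ℝ≥0) (f g : NoiseL2 𝔨)
    (hg : g =ᵐ[leb] (Set.Iio t).indicator f) :
    fockVacProj 𝔨 t (expVec f) = expVec g := by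
  refine Submodule.eq_starProjection_of_mem_of_inner_eq_zero ?_ ?_
  · refine Submodule.le_topologicalClosure _ (Submodule.subset_span ⟨g, ?_, rfl⟩)
    filter_upwards [hg] with s hs hts
    rw [hs, Set.indicator_of_notMem (by simpa using hts)]
  · have key : Submodule.span ℂ {x | ∃ f : NoiseL2 𝔨, (∀ᵐ s ∂leb, t ≤ s → f s = 0) ∧
        x = expVec f} ≤ (innerSL ℂ (expVec f - expVec g)).ker := by
      refine Submodule.span_le.2 ?_
      rintro _ ⟨φ, hφ, rfl⟩
      have : inner ℂ f φ = inner ℂ g φ := by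
        rw [L2.inner_def, L2.inner_def]
        refine integral_congr_ae ?_
        filter_upwards [hg, hφ] with s hs h's
        by_cases hst : s < t
        · rw [hs, Set.indicator_of_mem (by simpa using hst)]
        · rw [h's (not_lt.1 hst)]
          simp
      simp [inner_expVec, this]
    have hcl := Submodule.topologicalClosure_minimal _ key
      (ContinuousLinearMap.isClosed_ker _)
    intro w hw
    exact hcl hw

end Fock

/-! ### Processes -/

section Processes

variable (𝔥 𝔨 : Type*)
  [NormedAddCommGroup 𝔥] [InnerProductSpace ℂ 𝔥]
  [NormedAddCommGroup 𝔨] [InnerProductSpace ℂ 𝔨]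

/-- The space `h ⊗ F`. -/
abbrev InitFock : Type _ := HTensor 𝔥 (Fock 𝔨)

/-- The Hilbert space `k̂ = ℂ ⊕ k`. -/
abbrev Hat : Type _ := WithLp 2 (ℂ × 𝔨)

/-- The space `k̂ ⊗ h ⊗ F`. -/
abbrev HatInitFock : Type _ := HTensor (Hat 𝔨) (InitFock 𝔥 𝔨)

variable {𝔨}

/-- The vector `ĉ = (1, c)`. -/
def hat (c : 𝔨) : Hat 𝔨 := WithLp.toLp 2 ((1 : ℂ), c)

variable (𝔨)

/-- The inclusion `c ↦ (0, c)` of `k` in `k̂`. -/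
def hatIncl : 𝔨 →L[ℂ] Hat 𝔨 :=
  (WithLp.prodContinuousLinearEquiv 2 ℂ ℂ 𝔨).symm.toContinuousLinearMap ∘L
    ContinuousLinearMap.inr ℂ ℂ 𝔨

/-- The projection `Δ = P_k ⊗ I` on `k̂ ⊗ h ⊗ F`, with `P_k (z, c) = (0, c)`. -/
def Delta : HatInitFock 𝔥 𝔨 →L[ℂ] HatInitFock 𝔥 𝔨 :=
  opTensor (hatIncl 𝔨 ∘L WithLp.sndL 2 ℂ ℂ 𝔨) (ContinuousLinearMap.id ℂ (InitFock 𝔥 𝔨))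

/-- The projection `P_t = I_h ⊗ I_{t)} ⊗ |Ω_{[t}⟩⟨Ω_{[t}|`. -/
def vacProj (t : ℝ≥0) : InitFock 𝔥 𝔨 →L[ℂ] InitFock 𝔥 𝔨 :=
  opTensor (ContinuousLinearMap.id ℂ 𝔥) (fockVacProj 𝔨 t)

variable {𝔥 𝔨}

/-- The ampliation `I ⊗ T` on `k̂ ⊗ h ⊗ F` of an operator `T` on `h ⊗ F`. -/
def ampl (T : InitFock 𝔥 𝔨 →L[ℂ] InitFock 𝔥 𝔨) : HatInitFock 𝔥 𝔨 →L[ℂ] HatInitFock 𝔥 𝔨 :=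
  opTensor (ContinuousLinearMap.id ℂ (Hat 𝔨)) T

/-- A bounded process in the von Neumann algebra `M`: a weakly measurable family of operators
in `M`. -/
structure IsBoundedProcess {L : Type*} [NormedAddCommGroup L] [InnerProductSpace ℂ L]
    [CompleteSpace L] (M : VonNeumannAlgebra L) (Z : ℝ≥0 → L →L[ℂ] L) : Prop where
  mem : ∀ t, Z t ∈ M
  measurable : ∀ ζ' ζ : L, Measurable fun t => inner ℂ ζ' (Z t ζ)

/-- `‖f‖_{p,t}`: the `L^p` norm of `1_{[0,t)} ‖f‖`. -/
def locNorm {B : Type*} [NormedAddCommGroup B] (p : ℝ≥0∞) (t : ℝ≥0) (f : ℝ≥0 → B) : ℝ≥0∞ :=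
  eLpNorm (fun s => ‖f s‖) p (leb.restrict (Set.Iio t))

/-! The entries of the block-matrix form `[k m; l n]` of an operator on
`k̂ ⊗ h ⊗ F = (h ⊗ F) ⊕ (k ⊗ h ⊗ F)`. -/

section Blocks

/-- The isometry `c ⊗ ξ ↦ (0, c) ⊗ ξ` of `k ⊗ h ⊗ F` into `k̂ ⊗ h ⊗ F`. -/
def inclNoise : HTensor 𝔨 (InitFock 𝔥 𝔨) →L[ℂ] HatInitFock 𝔥 𝔨 :=
  opTensor (hatIncl 𝔨) (ContinuousLinearMap.id ℂ (InitFock 𝔥 𝔨))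

/-- The isometry `ξ ↦ (1, 0) ⊗ ξ` of `h ⊗ F` into `k̂ ⊗ h ⊗ F`. -/
def inclTime : InitFock 𝔥 𝔨 →L[ℂ] HatInitFock 𝔥 𝔨 := ket _ (hat (0 : 𝔨))

/-- The entry `k : h ⊗ F → h ⊗ F`. -/
def blockK (G : HatInitFock 𝔥 𝔨 →L[ℂ] HatInitFock 𝔥 𝔨) :
    InitFock 𝔥 𝔨 →L[ℂ] InitFock 𝔥 𝔨 :=
  (inclTime).adjoint ∘L G ∘L inclTime

/-- The entry `l : h ⊗ F → k ⊗ h ⊗ F`. -/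
def blockL (G : HatInitFock 𝔥 𝔨 →L[ℂ] HatInitFock 𝔥 𝔨) :
    InitFock 𝔥 𝔨 →L[ℂ] HTensor 𝔨 (InitFock 𝔥 𝔨) :=
  (inclNoise).adjoint ∘L G ∘L inclTime

/-- The entry `m : k ⊗ h ⊗ F → h ⊗ F`. -/
def blockM (G : HatInitFock 𝔥 𝔨 →L[ℂ] HatInitFock 𝔥 𝔨) :
    HTensor 𝔨 (InitFock 𝔥 𝔨) →L[ℂ] InitFock 𝔥 𝔨 :=
  (inclTime).adjoint ∘L G ∘L inclNoise

/-- The entry `n : k ⊗ h ⊗ F → k ⊗ h ⊗ F`. -/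
def blockN (G : HatInitFock 𝔥 𝔨 →L[ℂ] HatInitFock 𝔥 𝔨) :
    HTensor 𝔨 (InitFock 𝔥 𝔨) →L[ℂ] HTensor 𝔨 (InitFock 𝔥 𝔨) :=
  (inclNoise).adjoint ∘L G ∘L inclNoise

end Blocks

variable [CompleteSpace 𝔥] [CompleteSpace 𝔨]

/-- A vacuum-adapted bounded process in `A`. -/
structure IsVacAdapted (A : VonNeumannAlgebra 𝔥)
    (Z : ℝ≥0 → InitFock 𝔥 𝔨 →L[ℂ] InitFock 𝔥 𝔨) : Prop where
  process : IsBoundedProcess (tensorVN A (fullVN (Fock 𝔨))) Z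
  adapted : ∀ t, Z t = vacProj 𝔥 𝔨 t ∘L Z t ∘L vacProj 𝔥 𝔨 t

/-- An integrand process: a vacuum-adapted bounded process in `B(k̂) ⊗ A` such that
`‖k‖_{1,t} + ‖l‖_{2,t} + ‖m‖_{2,t} + ‖n‖_{∞,t} < ∞` for all `t`. -/
structure IsIntegrand (A : VonNeumannAlgebra 𝔥)
    (G : ℝ≥0 → HatInitFock 𝔥 𝔨 →L[ℂ] HatInitFock 𝔥 𝔨) : Prop where
  process : IsBoundedProcess (tensorVN (fullVN (Hat 𝔨)) (tensorVN A (fullVN (Fock 𝔨)))) G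
  adapted : ∀ t, G t = ampl (vacProj 𝔥 𝔨 t) ∘L G t ∘L ampl (vacProj 𝔥 𝔨 t)
  finite : ∀ t, locNorm 1 t (fun s => blockK (G s)) + locNorm 2 t (fun s => blockL (G s)) +
    locNorm 2 t (fun s => blockM (G s)) + locNorm ∞ t (fun s => blockN (G s)) < ∞

/-- `Y` is the quantum stochastic integral `(∫₀ᵗ G_s dΛ_s)_{t ≥ 0}` of the integrand process `G`:
the vacuum-adapted bounded process in `A` such that
`⟪u ε(f), Y_t v ε(g)⟫ = ∫₀ᵗ ⟪u ε(f), E^{f̂(s)} G_s E_{ĝ(s)} v ε(g)⟫ ds`. -/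
structure IsQSIntegral (A : VonNeumannAlgebra 𝔥)
    (G : ℝ≥0 → HatInitFock 𝔥 𝔨 →L[ℂ] HatInitFock 𝔥 𝔨)
    (Y : ℝ≥0 → InitFock 𝔥 𝔨 →L[ℂ] InitFock 𝔥 𝔨) : Prop where
  integrand : IsIntegrand A G
  adapted : IsVacAdapted A Y
  inner_eq : ∀ (t : ℝ≥0) (u v : 𝔥) (f g : NoiseL2 𝔨),
    inner ℂ (tmul u (expVec f)) (Y t (tmul v (expVec g))) =
      ∫ s in Set.Iio t, inner ℂ (tmul u (expVec f))
        ((ket (InitFock 𝔥 𝔨) (hat (f s))).adjoint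
          (G s (ket (InitFock 𝔥 𝔨) (hat (g s)) (tmul v (expVec g))))) ∂leb

/-- `Z` is a vacuum-adapted process in `A` with `Z_t = X_t + ∫₀ᵗ G_s (I ⊗ Z_s) dΛ_s` for all
`t ≥ 0`; in particular `G_s (I ⊗ Z_s)` is an integrand process, so that the integral is defined. -/
structure IsSolution (A : VonNeumannAlgebra 𝔥)
    (G : ℝ≥0 → HatInitFock 𝔥 𝔨 →L[ℂ] HatInitFock 𝔥 𝔨)
    (X Z : ℝ≥0 → InitFock 𝔥 𝔨 →L[ℂ] InitFock 𝔥 𝔨) : Prop where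
  adapted : IsVacAdapted A Z
  eqn : ∃ Y, IsQSIntegral A (fun s => G s ∘L ampl (Z s)) Y ∧ ∀ t, Z t = X t + Y t

end Processes

end VacQSDE

end

set_option linter.unusedSectionVars false

noncomputable section

namespace VacQSDE

/-! ### Tensor products -/

section Tensor

variable {E F E' F' E'' F'' : Type*}
  [NormedAddCommGroup E] [InnerProductSpace ℂ E]
  [NormedAddCommGroup F] [InnerProductSpace ℂ F]
  [NormedAddCommGroup E'] [InnerProductSpace ℂ E']
  [NormedAddCommGroup F'] [InnerProductSpace ℂ F']
  [NormedAddCommGroup E''] [InnerProductSpace ℂ E'']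
  [NormedAddCommGroup F''] [InnerProductSpace ℂ F'']

/-! The proof rests on an operator form of the vacuum-adapted Itô isometry. Let the adapted gradient
send u ⊗ ε(f) to the function s ↦ f(s) ⊗ u ⊗ ε(1_{[0,s)} f). The inner product of two such functions
is ⟨u,v⟩ ∫ φ(s) exp(∫_0^s φ) ds with φ = ⟨f(·), g(·)⟩, which the fundamental theorem of calculus
evaluates to ⟨u,v⟩ (exp ⟨f,g⟩ − 1). So the gradient loses exactly the vacuum component and extends
to a contraction `grad` (`inner_gradExp`, `norm_gradComb_le`).

If G_t Δ = 0, then G_s E_ĉ does not depend on c, and only the column (k, l) enters the integral.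
Vacuum adaptedness allows ε(f) to be truncated at time s inside the integrand, so the integral over
S is the operator ζ ↦ ∫_S k_s ζ ds + grad* (1_S l ζ). This gives existence together with the bound
‖k‖_1 + ‖l‖_2 (`ColIntegrable.exists_isColInt`). Increments obey the same bound, so integrals are
norm continuous. Membership in the algebra follows from the double commutant description, since the
commutant of A ⊗ B(F) consists of operators b ⊗ I, which leave exponential vectors alone.

Apply the bound to the integrands G(I ⊗ Z) and G(I ⊗ Z'), square it and use Cauchy–Schwarz for the
measure ‖k_s‖ ds. For t ≤ T this yields ‖Y_t − Y'_t‖² ≤ ½ ∫_0^t w ‖Z − Z'‖² with the integrable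
weight w = 4(‖l‖² + ‖k‖_{1,T} ‖k‖) (`IsQSIntegral.norm_sub_sq_le`). The rest follows from this
inequality. Picard differences are O(2^{-n/2}) uniformly on [0, T], because ½ ∫_0^t w exp(∫_0^s w)
ds ≤ ½ exp(∫_0^t w). Gronwall's inequality gives uniqueness. Gronwall applied to ‖Z‖² ≤ 2‖X‖² +
2‖Y‖² gives the stated bound, since ∫_0^T w = 4‖l‖² + 4‖k‖_1². Finally Z − X is an integral, hence
norm continuous. -/

/-- The continuous bilinear map `(x, y) ↦ x ⊗ y`. -/
def tmulL (E F : Type*) [NormedAddCommGroup E] [InnerProductSpace ℂ E]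
    [NormedAddCommGroup F] [InnerProductSpace ℂ F] : E →L[ℂ] F →L[ℂ] HTensor E F :=
  (ContinuousLinearMap.compL ℂ F (E ⊗[ℂ] F) (HTensor E F) ofAlg.toContinuousLinearMap) ∘L
    TensorProduct.mkL ℂ E F

theorem tmulL_apply (x : E) (y : F) : tmulL E F x y = tmul x y := rfl

theorem ket_apply (x : E) (y : F) : ket F x y = tmul x y := rfl

theorem ofAlg_tmul (x : E) (y : F) : ofAlg (x ⊗ₜ[ℂ] y) = tmul x y := rfl

theorem norm_tmul (x : E) (y : F) : ‖tmul x y‖ = ‖x‖ * ‖y‖ := by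
  rw [← ofAlg_tmul, LinearIsometry.norm_map, TensorProduct.norm_tmul]

theorem tmul_add_left (x x' : E) (y : F) : tmul (x + x') y = tmul x y + tmul x' y := by
  simp [← tmulL_apply]

/-- A closed subspace that contains the elementary tensors of two total sets is everything. -/
theorem tmul_mem_closed {s : Set E} {t : Set F}
    (hs : (Submodule.span ℂ s).topologicalClosure = ⊤)
    (ht : (Submodule.span ℂ t).topologicalClosure = ⊤)
    (W : Submodule ℂ (HTensor E F)) (hW : IsClosed (W : Set (HTensor E F)))
    (h : ∀ x ∈ s, ∀ y ∈ t, tmul x y ∈ W) (z : HTensor E F) : z ∈ W := by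
  have h1 : ∀ x ∈ s, ∀ y, tmul x y ∈ W := by
    intro x hx y
    have := Submodule.topologicalClosure_minimal (Submodule.span ℂ t)
      (t := W.comap (tmulL E F x).toLinearMap)
      (Submodule.span_le.2 fun y hy => h x hx y hy) (hW.preimage (tmulL E F x).continuous)
    exact this (ht ▸ Submodule.mem_top : y ∈ _)
  have h2 : ∀ x y, tmul x y ∈ W := by
    intro x y
    have := Submodule.topologicalClosure_minimal (Submodule.span ℂ s)
      (t := W.comap ((tmulL E F).flip y).toLinearMap)
      (Submodule.span_le.2 fun x hx => h1 x hx y) (hW.preimage ((tmulL E F).flip y).continuous)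
    exact this (hs ▸ Submodule.mem_top : x ∈ _)
  refine (denseRange_ofAlg (E := E) (F := F)).induction_on z hW fun a => ?_
  induction a using TensorProduct.induction_on with
  | zero => simp
  | tmul x y => exact h2 x y
  | add a b ha hb => rw [map_add]; exact W.add_mem ha hb

theorem span_univ_closure (E : Type*) [NormedAddCommGroup E] [InnerProductSpace ℂ E] :
    (Submodule.span ℂ (Set.univ : Set E)).topologicalClosure = ⊤ := by
  rw [Submodule.span_univ]
  exact eq_top_iff.2 (Submodule.le_topologicalClosure _)

theorem ext_tmul {K : Type*} [NormedAddCommGroup K] [NormedSpace ℂ K]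
    {S T : HTensor E F →L[ℂ] K} (h : ∀ x y, S (tmul x y) = T (tmul x y)) : S = T := by
  ext z
  have := tmul_mem_closed (span_univ_closure E) (span_univ_closure F) (S - T).ker
    (S - T).isClosed_ker (fun x _ y _ => by simp [h]) z
  simpa [sub_eq_zero] using this

theorem opTensor_comp (S : E' →L[ℂ] E'') (T : F' →L[ℂ] F'') (S' : E →L[ℂ] E')
    (T' : F →L[ℂ] F') : opTensor S T ∘L opTensor S' T' = opTensor (S ∘L S') (T ∘L T') :=
  ext_tmul fun x y => by simp [opTensor_tmul]

theorem opTensor_adjoint [CompleteSpace E] [CompleteSpace F] [CompleteSpace E'] [CompleteSpace F']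
    (S : E →L[ℂ] E') (T : F →L[ℂ] F') :
    (opTensor S T).adjoint = opTensor S.adjoint T.adjoint := by
  refine ext_tmul fun x y => ?_
  refine ext_inner_right ℂ fun z => ?_
  have := tmul_mem_closed (span_univ_closure E) (span_univ_closure F)
    (innerSL ℂ ((opTensor S T).adjoint (tmul x y)) -
      innerSL ℂ (opTensor S.adjoint T.adjoint (tmul x y))).ker
    (ContinuousLinearMap.isClosed_ker _) (fun x' _ y' _ => by
      simp [ContinuousLinearMap.adjoint_inner_left, opTensor_tmul, inner_tmul]) z
  simpa [sub_eq_zero] using this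

theorem ket_adjoint_tmul [CompleteSpace F] (u x : E) (y : F) :
    (ket F u).adjoint (tmul x y) = (inner ℂ u x : ℂ) • y := by
  refine ext_inner_left ℂ fun z => ?_
  rw [ContinuousLinearMap.adjoint_inner_right, ket_apply, inner_tmul, inner_smul_right]

/-- The map `x ↦ x ⊗ y`. -/
def rket (E : Type*) [NormedAddCommGroup E] [InnerProductSpace ℂ E] (y : F) :
    E →L[ℂ] HTensor E F := (tmulL E F).flip y

theorem rket_apply (x : E) (y : F) : rket E y x = tmul x y := rfl

theorem rket_adjoint_tmul [CompleteSpace E] (y' : F) (x : E) (y : F) :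
    (rket E y').adjoint (tmul x y) = (inner ℂ y' y : ℂ) • x := by
  refine ext_inner_left ℂ fun z => ?_
  rw [ContinuousLinearMap.adjoint_inner_right, rket_apply, inner_tmul, inner_smul_right, mul_comm]

instance [TopologicalSpace.SeparableSpace E] [TopologicalSpace.SeparableSpace F] :
    TopologicalSpace.SeparableSpace (HTensor E F) := by
  have h1 : TopologicalSpace.IsSeparable (Set.range fun p : E × F => tmul p.1 p.2) :=
    TopologicalSpace.isSeparable_range
      ((tmulL E F).continuous₂)
  have h2 := (h1.span (R := ℂ)).closure
  rw [← TopologicalSpace.isSeparable_univ_iff]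
  refine h2.mono fun z _ => ?_
  exact tmul_mem_closed (span_univ_closure E) (span_univ_closure F)
    (Submodule.span ℂ (Set.range fun p : E × F => tmul p.1 p.2)).topologicalClosure
    (Submodule.isClosed_topologicalClosure _)
    (fun x _ y _ => Submodule.le_topologicalClosure _ (Submodule.subset_span ⟨(x, y), rfl⟩)) z

/-! ### Generated von Neumann algebras -/

section VN

variable {H : Type*} [NormedAddCommGroup H] [InnerProductSpace ℂ H] [CompleteSpace H]

/-- `B` commutes with `S` and with the adjoints of the elements of `S`. -/
def StarCommutes (S : Set (H →L[ℂ] H)) (B : H →L[ℂ] H) : Prop :=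
  ∀ g ∈ S, g ∘L B = B ∘L g ∧ g.adjoint ∘L B = B ∘L g.adjoint

theorem StarCommutes.adjoint {S : Set (H →L[ℂ] H)} {B : H →L[ℂ] H} (h : StarCommutes S B) :
    StarCommutes S B.adjoint := fun g hg => by
  obtain ⟨h1, h2⟩ := h g hg
  refine ⟨?_, ?_⟩
  · simpa [ContinuousLinearMap.adjoint_comp] using
      (congrArg ContinuousLinearMap.adjoint h2).symm
  · simpa [ContinuousLinearMap.adjoint_comp] using
      (congrArg ContinuousLinearMap.adjoint h1).symm

theorem starCommutes_iff {S : Set (H →L[ℂ] H)} {B : H →L[ℂ] H} :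
    StarCommutes S B ↔ B ∈ StarSubalgebra.centralizer ℂ S := by
  rw [StarSubalgebra.mem_centralizer_iff]
  rfl

/-- The operators commuting with S ∪ S* are closed under adjoints, so one commutation relation
against each of them suffices. -/
theorem mem_generatedVN {S : Set (H →L[ℂ] H)} {T : H →L[ℂ] H} :
    T ∈ generatedVN S ↔ ∀ B, StarCommutes S B → B ∘L T = T ∘L B := by
  change T ∈ StarSubalgebra.centralizer ℂ (StarSubalgebra.centralizer ℂ S : Set _) ↔ _
  rw [StarSubalgebra.mem_centralizer_iff]
  constructor
  · intro h B hB
    exact (h B (starCommutes_iff.1 hB)).1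
  · intro h B hB
    have hB' := starCommutes_iff.2 hB
    exact ⟨h B hB', h _ hB'.adjoint⟩

theorem subset_generatedVN {S : Set (H →L[ℂ] H)} {T : H →L[ℂ] H} (hT : T ∈ S) :
    T ∈ generatedVN S := mem_generatedVN.2 fun _ hB => (hB T hT).1.symm

theorem mem_fullVN (T : H →L[ℂ] H) : T ∈ fullVN H := by
  change T ∈ (⊤ : StarSubalgebra ℂ (H →L[ℂ] H))
  trivial

theorem opTensor_mem_tensorVN [CompleteSpace E] [CompleteSpace F]
    {M : VonNeumannAlgebra E} {N : VonNeumannAlgebra F} {a : E →L[ℂ] E} {b : F →L[ℂ] F}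
    (ha : a ∈ M) (hb : b ∈ N) : opTensor a b ∈ tensorVN M N :=
  subset_generatedVN ⟨a, ha, b, hb, rfl⟩

/-- Operators commuting with `1 ⊗ B(F)` have the form `b ⊗ 1`. -/
theorem exists_of_starCommutes_tensor_full [CompleteSpace E] [CompleteSpace F]
    (M : VonNeumannAlgebra E) (e : F) (he : ‖e‖ = 1) {B : HTensor E F →L[ℂ] HTensor E F}
    (hB : StarCommutes {T | ∃ a ∈ M, ∃ b ∈ fullVN F, T = opTensor a b} B) :
    ∃ b : E →L[ℂ] E, ∀ x y, B (tmul x y) = tmul (b x) y := by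
  refine ⟨(rket E e).adjoint ∘L B ∘L rket E e, fun x y => ?_⟩
  -- R is I ⊗ |y⟩⟨e|, which B must commute with. It sends x ⊗ e to x ⊗ y and factors through the
  -- adjoint of x ↦ x ⊗ e, so B R = R B forces b to be the compression of B to the vector e.
  set R : HTensor E F →L[ℂ] HTensor E F :=
    opTensor (ContinuousLinearMap.id ℂ E) ((innerSL ℂ e).smulRight y) with hR
  have hRB : R ∘L B = B ∘L R :=
    (hB R ⟨_, one_mem M, _, mem_fullVN _, rfl⟩).1
  have h1 : R = rket E y ∘L (rket E e).adjoint := by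
    refine ext_tmul fun x' y' => ?_
    rw [hR, opTensor_tmul, ContinuousLinearMap.comp_apply, rket_adjoint_tmul, map_smul,
      rket_apply]
    simp [← tmulL_apply]
  have h2 : R (tmul x e) = tmul x y := by
    rw [hR, opTensor_tmul]
    simp [he, inner_self_eq_norm_sq_to_K]
  rw [← h2, ← ContinuousLinearMap.comp_apply, ← hRB, h1]
  rfl

end VN

end Tensor

/-! ### Weak and strong measurability -/

section Measurability

variable {α : Type*} [MeasurableSpace α]
  {E F K : Type*}
  [NormedAddCommGroup E] [InnerProductSpace ℂ E]
  [NormedAddCommGroup F] [InnerProductSpace ℂ F]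
  [NormedAddCommGroup K] [InnerProductSpace ℂ K]

/-- By density the bound on inner products holds for every vector, in particular for x itself. This
makes closed balls countable intersections of weakly measurable conditions. -/
theorem norm_le_iff_denseRange_inner {y : ℕ → E} (hy : DenseRange y) (x : E) {r : ℝ} (hr : 0 ≤ r) :
    ‖x‖ ≤ r ↔ ∀ n, ‖inner ℂ (y n) x‖ ≤ r * ‖y n‖ := by
  constructor
  · intro h n
    rw [mul_comm]
    exact (norm_inner_le_norm _ _).trans (by gcongr)
  · intro h
    have h2 : ∀ z, ‖inner ℂ z x‖ ≤ r * ‖z‖ := fun z =>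
      hy.induction_on (p := fun z => ‖inner ℂ z x‖ ≤ r * ‖z‖) z
        (isClosed_le (by fun_prop) (by fun_prop)) h
    have h3 := h2 x
    rw [inner_self_eq_norm_sq_to_K] at h3
    rcases eq_or_ne ‖x‖ 0 with h0 | h0
    · rw [h0]; exact hr
    · have : ‖x‖ * ‖x‖ ≤ r * ‖x‖ := by simpa [pow_two] using h3
      exact le_of_mul_le_mul_right this (lt_of_le_of_ne (norm_nonneg _) (Ne.symm h0))

/-- Pettis' theorem in a separable inner product space. -/
theorem stronglyMeasurable_of_inner [TopologicalSpace.SeparableSpace E] {x : α → E}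
    (h : ∀ z, Measurable fun a => inner ℂ z (x a)) : StronglyMeasurable x := by
  borelize E
  have := UniformSpace.secondCountable_of_separable E
  refine Measurable.stronglyMeasurable (measurable_of_isOpen fun U hU => ?_)
  obtain ⟨y, hy⟩ := TopologicalSpace.exists_dense_seq E
  have hball : ∀ (c : E) (r : ℝ), 0 ≤ r → MeasurableSet {a | ‖x a - c‖ ≤ r} := by
    intro c r hr
    simp only [norm_le_iff_denseRange_inner hy _ hr, Set.ofPred_forall]
    refine MeasurableSet.iInter fun n => measurableSet_le ?_ measurable_const
    simp only [inner_sub_right]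
    exact ((h (y n)).sub_const _).norm
  -- An open set is a countable union of closed balls with centres in the dense sequence and
  -- rational radii.
  have hcover : x ⁻¹' U = ⋃ p : {p : ℕ × ℚ // 0 ≤ p.2 ∧ Metric.closedBall (y p.1) (p.2 : ℝ) ⊆ U},
      {a | ‖x a - y p.1.1‖ ≤ (p.1.2 : ℝ)} := by
    ext a
    simp only [Set.mem_preimage, Set.mem_iUnion, Set.mem_ofPred_eq]
    constructor
    · intro ha
      obtain ⟨ε, hε, hεU⟩ := Metric.isOpen_iff.1 hU _ ha
      obtain ⟨q, hq0, hq⟩ := exists_rat_btwn (half_pos hε)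
      obtain ⟨n, hn⟩ := hy.exists_dist_lt (x a) hq0
      refine ⟨⟨(n, q), ⟨by exact_mod_cast hq0.le, fun z hz => hεU ?_⟩⟩, ?_⟩
      · rw [Metric.mem_ball]
        rw [Metric.mem_closedBall] at hz
        calc dist z (x a) ≤ dist z (y n) + dist (y n) (x a) := dist_triangle _ _ _
          _ < ε := by rw [dist_comm (y n)]; simp only at hz; linarith
      · rw [← dist_eq_norm]; exact hn.le
    · rintro ⟨p, hp⟩
      exact p.2.2 (by rwa [Metric.mem_closedBall, dist_eq_norm])
  rw [hcover]
  exact MeasurableSet.iUnion fun p => hball _ _ (by exact_mod_cast p.2.1)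

/-- A weakly measurable family of bounded operators. -/
def WeakMeas (T : α → E →L[ℂ] F) : Prop :=
  ∀ (y : F) (x : E), Measurable fun a => inner ℂ y (T a x)

theorem WeakMeas.apply [TopologicalSpace.SeparableSpace F] {T : α → E →L[ℂ] F}
    (hT : WeakMeas T) (x : E) : StronglyMeasurable fun a => T a x :=
  stronglyMeasurable_of_inner fun z => hT z x

theorem WeakMeas.adjoint [CompleteSpace E] [CompleteSpace F] {T : α → E →L[ℂ] F}
    (hT : WeakMeas T) : WeakMeas fun a => (T a).adjoint := fun x y => by
  simp only [ContinuousLinearMap.adjoint_inner_right]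
  have := Complex.continuous_conj.measurable.comp (hT y x)
  simpa only [Function.comp_def, inner_conj_symm] using this

theorem WeakMeas.sub {S T : α → E →L[ℂ] F} (hS : WeakMeas S) (hT : WeakMeas T) :
    WeakMeas fun a => S a - T a := fun y x => by
  simp only [sub_apply, inner_sub_right]
  exact (hS y x).sub (hT y x)

theorem WeakMeas.comp_const_left [CompleteSpace K] [CompleteSpace F] {T : α → E →L[ℂ] F}
    (hT : WeakMeas T) (S : F →L[ℂ] K) :
    WeakMeas fun a => S ∘L T a := fun y x => by
  simpa [← ContinuousLinearMap.adjoint_inner_left] using hT (S.adjoint y) x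

theorem WeakMeas.comp_const_right {T : α → E →L[ℂ] F} (hT : WeakMeas T) (S : K →L[ℂ] E) :
    WeakMeas fun a => T a ∘L S := fun y x => hT y (S x)

/-- Write ⟨y, S T x⟩ = ⟨S* y, T x⟩. By Pettis both arguments are strongly measurable, and so is
their inner product; this is where separability of the middle space enters. -/
theorem WeakMeas.comp [CompleteSpace E] [CompleteSpace F]
    [TopologicalSpace.SeparableSpace E] {S : α → E →L[ℂ] F}
    {T : α → K →L[ℂ] E} (hS : WeakMeas S) (hT : WeakMeas T) : WeakMeas fun a => S a ∘L T a := by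
  intro y x
  have h1 := (hS.adjoint).apply y
  have h2 := hT.apply x
  have := (h1.inner (𝕜 := ℂ) h2).measurable
  simpa [ContinuousLinearMap.adjoint_inner_left] using this

theorem opNorm_le_iff_denseRange {x : ℕ → E} (hx : DenseRange x) (T : E →L[ℂ] F) {r : ℝ}
    (hr : 0 ≤ r) : ‖T‖ ≤ r ↔ ∀ n, ‖T (x n)‖ ≤ r * ‖x n‖ :=
  ⟨fun h n => T.le_of_opNorm_le h _, fun h => T.opNorm_le_bound hr fun z =>
    hx.induction_on (p := fun z => ‖T z‖ ≤ r * ‖z‖) z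
        (isClosed_le (by fun_prop) (by fun_prop)) h⟩

theorem WeakMeas.norm [TopologicalSpace.SeparableSpace E] [TopologicalSpace.SeparableSpace F]
    {T : α → E →L[ℂ] F} (hT : WeakMeas T) : Measurable fun a => ‖T a‖ := by
  obtain ⟨x, hx⟩ := TopologicalSpace.exists_dense_seq E
  refine measurable_of_Iic fun r => ?_
  rcases lt_or_ge r 0 with hr | hr
  · have : (fun a => ‖T a‖) ⁻¹' Set.Iic r = ∅ := by
      ext a
      simpa using hr.trans_le (norm_nonneg (T a))
    rw [this]
    exact MeasurableSet.empty
  · have : (fun a => ‖T a‖) ⁻¹' Set.Iic r = ⋂ n, {a | ‖T a (x n)‖ ≤ r * ‖x n‖} := by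
      ext a
      simp [opNorm_le_iff_denseRange hx (T a) hr]
    rw [this]
    exact MeasurableSet.iInter fun n =>
      measurableSet_le (hT.apply (x n)).norm.measurable measurable_const

end Measurability

/-! ### Lebesgue measure on the half-line -/

section Leb

theorem measurableEmbedding_coe_nnreal : MeasurableEmbedding ((↑) : ℝ≥0 → ℝ) :=
  MeasurableEmbedding.subtype_coe measurableSet_Ici

theorem map_coe_leb : Measure.map ((↑) : ℝ≥0 → ℝ) leb = volume.restrict (Set.Ici (0 : ℝ)) := by
  have := measurableEmbedding_coe_nnreal.map_comap volume
  rw [leb, this]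
  congr 1
  ext x
  exact ⟨fun ⟨y, hy⟩ => hy ▸ y.2, fun hx => ⟨⟨x, hx⟩, rfl⟩⟩

instance : SigmaFinite leb := by
  refine SigmaFinite.of_map leb measurableEmbedding_coe_nnreal.measurable.aemeasurable ?_
  rw [map_coe_leb]
  infer_instance

theorem leb_singleton (t : ℝ≥0) : leb {t} = 0 := by
  rw [leb, measurableEmbedding_coe_nnreal.comap_apply]
  simp

theorem integral_leb {E : Type*} [NormedAddCommGroup E] [NormedSpace ℝ E] (g : ℝ → E) :
    ∫ s, g s ∂leb = ∫ x in Set.Ioi (0 : ℝ), g x := by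
  rw [← integral_Ici_eq_integral_Ioi, ← map_coe_leb, measurableEmbedding_coe_nnreal.integral_map]

theorem setIntegral_Iio_leb {E : Type*} [NormedAddCommGroup E] [NormedSpace ℝ E] (g : ℝ → E)
    (t : ℝ≥0) : ∫ s in Set.Iio t, g s ∂leb = ∫ x in (0 : ℝ)..t, g x := by
  rw [← integral_indicator measurableSet_Iio]
  have h1 : (fun s : ℝ≥0 => (Set.Iio t).indicator (fun s : ℝ≥0 => g s) s) =
      fun s : ℝ≥0 => (Set.Iio (t : ℝ)).indicator g s := by
    ext s
    simp [Set.indicator]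
  rw [h1, integral_leb, integral_indicator measurableSet_Iio,
    Measure.restrict_restrict measurableSet_Iio, Set.Iio_inter_Ioi,
    ← integral_Ioc_eq_integral_Ioo, intervalIntegral.integral_of_le t.coe_nonneg]

theorem integrable_leb_iff {E : Type*} [NormedAddCommGroup E] {g : ℝ → E} :
    Integrable (fun s : ℝ≥0 => g s) leb ↔ IntegrableOn g (Set.Ici 0) := by
  rw [IntegrableOn, ← map_coe_leb, measurableEmbedding_coe_nnreal.integrable_map_iff]
  rfl

/-- Dominated convergence: the indicators of [0,r) converge as r → t except at s = t, and a point is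
a null set. -/
theorem continuous_setIntegral_Iio {E : Type*} [NormedAddCommGroup E] [NormedSpace ℝ E]
    {g : ℝ≥0 → E} (hg : Integrable g leb) : Continuous fun t => ∫ s in Set.Iio t, g s ∂leb := by
  simp_rw [← integral_indicator measurableSet_Iio]
  refine continuous_iff_continuousAt.2 fun t => ?_
  refine continuousAt_of_dominated (bound := fun s => ‖g s‖)
    (Filter.Eventually.of_forall fun r => (hg.indicator measurableSet_Iio).aestronglyMeasurable)
    (Filter.Eventually.of_forall fun r => Filter.Eventually.of_forall fun s =>
      norm_indicator_le_norm_self _ _) hg.norm ?_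
  have h0 : ∀ᵐ s ∂leb, s ≠ t := by
    rw [ae_iff]
    simpa using leb_singleton t
  filter_upwards [h0] with s hs
  rcases lt_or_gt_of_ne hs with h | h
  · refine ContinuousAt.congr (f := fun _ => g s) continuousAt_const ?_
    filter_upwards [lt_mem_nhds h] with r hr
    rw [Set.indicator_of_mem (by simpa using hr)]
  · refine ContinuousAt.congr (f := fun _ => 0) continuousAt_const ?_
    filter_upwards [gt_mem_nhds h] with r hr
    rw [Set.indicator_of_notMem (by simpa using hr.le)]

theorem integral_mul_exp_of_continuous {f : ℝ → ℂ} (hf : Continuous f) (hfi : Integrable f) :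
    ∫ x in Set.Ioi (0 : ℝ), f x * Complex.exp (∫ y in (0 : ℝ)..x, f y) =
      Complex.exp (∫ x in Set.Ioi (0 : ℝ), f x) - 1 := by
  have hd : ∀ x, HasDerivAt (fun x => Complex.exp (∫ y in (0 : ℝ)..x, f y))
      (f x * Complex.exp (∫ y in (0 : ℝ)..x, f y)) x := by
    intro x
    have := (hf.integral_hasStrictDerivAt 0 x).hasDerivAt.cexp
    simpa [mul_comm] using this
  have hlim : Filter.Tendsto (fun x => Complex.exp (∫ y in (0 : ℝ)..x, f y)) Filter.atTop
      (nhds (Complex.exp (∫ x in Set.Ioi (0 : ℝ), f x))) :=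
    (Complex.continuous_exp.tendsto _).comp
      (intervalIntegral_tendsto_integral_Ioi 0 hfi.integrableOn Filter.tendsto_id)
  have hint : IntegrableOn (fun x => f x * Complex.exp (∫ y in (0 : ℝ)..x, f y))
      (Set.Ioi 0) := by
    refine (hfi.integrableOn.mul_const (Real.exp (∫ y, ‖f y‖) : ℂ)).mono ?_ ?_
    · exact (hf.mul (Continuous.cexp (intervalIntegral.continuous_primitive
        (fun a b => hf.intervalIntegrable a b) 0))).aestronglyMeasurable
    · refine Filter.Eventually.of_forall fun x => ?_
      rw [norm_mul, norm_mul]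
      refine mul_le_mul_of_nonneg_left ?_ (norm_nonneg _)
      rw [Complex.norm_exp, Complex.norm_real, Real.norm_of_nonneg (Real.exp_pos _).le]
      refine Real.exp_le_exp.2 ((Complex.re_le_norm _).trans ?_)
      refine (intervalIntegral.norm_integral_le_integral_norm_uIoc).trans ?_
      exact setIntegral_le_integral hfi.norm (Filter.Eventually.of_forall fun _ => norm_nonneg _)
  have := integral_Ioi_of_hasDerivAt_of_tendsto (hd 0).continuousAt.continuousWithinAt
    (fun x _ => hd x) hint hlim
  simpa using this

theorem norm_setIntegral_le_integral_norm {φ : ℝ≥0 → ℂ} (hφ : Integrable φ leb)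
    (s : Set ℝ≥0) : ‖∫ r in s, φ r ∂leb‖ ≤ ∫ r, ‖φ r‖ ∂leb :=
  (norm_integral_le_integral_norm _).trans
    (setIntegral_le_integral hφ.norm (Filter.Eventually.of_forall fun _ => norm_nonneg _))

theorem integrable_mul_exp {φ : ℝ≥0 → ℂ} (hφ : Integrable φ leb) :
    Integrable (fun s => φ s * Complex.exp (∫ r in Set.Iio s, φ r ∂leb)) leb := by
  refine (hφ.mul_const (Real.exp (∫ y, ‖φ y‖ ∂leb) : ℂ)).mono ?_ ?_
  · exact hφ.aestronglyMeasurable.mul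
      (Continuous.cexp (continuous_setIntegral_Iio hφ)).aestronglyMeasurable
  · refine Filter.Eventually.of_forall fun x => ?_
    rw [norm_mul, norm_mul]
    refine mul_le_mul_of_nonneg_left ?_ (norm_nonneg _)
    rw [Complex.norm_exp, Complex.norm_real, Real.norm_of_nonneg (Real.exp_pos _).le]
    exact Real.exp_le_exp.2 ((Complex.re_le_norm _).trans
      (norm_setIntegral_le_integral_norm hφ _))

/-- Factor out e^a; the condition δ ≤ 1 is what permits the linear bound |e^z − 1| ≤ 2|z|. -/
theorem norm_exp_sub_exp_le {a b : ℂ} {C δ : ℝ} (ha : ‖a‖ ≤ C) (hab : ‖b - a‖ ≤ δ) (hδ : δ ≤ 1) :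
    ‖Complex.exp b - Complex.exp a‖ ≤ Real.exp C * (2 * δ) := by
  have h : Complex.exp b - Complex.exp a = Complex.exp a * (Complex.exp (b - a) - 1) := by
    rw [mul_sub, ← Complex.exp_add]; ring_nf
  rw [h, norm_mul]
  refine mul_le_mul ?_ ((Complex.norm_exp_sub_one_le (hab.trans hδ)).trans (by linarith))
    (norm_nonneg _) (Real.exp_pos _).le
  rw [Complex.norm_exp]
  exact Real.exp_le_exp.2 ((Complex.re_le_norm _).trans ha)

/-- The fundamental theorem of calculus for the exponential of a primitive. -/
theorem integral_mul_exp {φ : ℝ≥0 → ℂ} (hφ : Integrable φ leb) :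
    ∫ s, φ s * Complex.exp (∫ r in Set.Iio s, φ r ∂leb) ∂leb =
      Complex.exp (∫ s, φ s ∂leb) - 1 := by
  set C : ℝ := ∫ r, ‖φ r‖ ∂leb with hC
  -- K δ is the total error of replacing φ by an L¹-approximation within δ on both sides: the first
  -- two terms of K come from the left side, the last from the right.
  set K : ℝ := Real.exp (C + 1) + C * (Real.exp C * 2) + Real.exp C * 2 with hK
  have hC0 : 0 ≤ C := integral_nonneg fun _ => norm_nonneg _
  have hKpos : 0 < K := by positivity
  refine eq_of_sub_eq_zero (norm_le_zero_iff.1 (le_of_forall_pos_le_add fun ε hε => ?_))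
  rw [zero_add]
  obtain ⟨δ, hδ0, hδ1, hδε⟩ : ∃ δ : ℝ, 0 < δ ∧ δ ≤ 1 ∧ K * δ ≤ ε := by
    refine ⟨min 1 (ε / K), lt_min one_pos (div_pos hε hKpos), min_le_left _ _, ?_⟩
    calc K * min 1 (ε / K) ≤ K * (ε / K) := by gcongr; exact min_le_right _ _
      _ = ε := by field_simp
  have hφ' : Integrable ((Set.Ici (0 : ℝ)).indicator fun x => φ x.toNNReal) := by
    rw [integrable_indicator_iff measurableSet_Ici, ← integrable_leb_iff]
    simpa using hφ
  -- φ is only integrable, so its primitive need not be differentiable everywhere. Continuous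
  -- functions, for which the classical theorem applies, are dense in L¹.
  obtain ⟨g, -, hgδ, hgc, hgi⟩ := hφ'.exists_hasCompactSupport_integral_sub_le hδ0
  have hgi' : Integrable (fun s : ℝ≥0 => g s) leb := integrable_leb_iff.2 hgi.integrableOn
  have hdist : ∫ s, ‖g s - φ s‖ ∂leb ≤ δ := by
    have h1 := integral_leb fun x => ‖g x - φ x.toNNReal‖
    simp only [Real.toNNReal_coe] at h1
    rw [h1]
    refine le_trans ?_ hgδ
    rw [← integral_Ici_eq_integral_Ioi]
    refine le_trans (le_of_eq ?_) (setIntegral_le_integral (s := Set.Ici (0 : ℝ))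
      ((hφ'.sub hgi).norm) (Filter.Eventually.of_forall fun _ => norm_nonneg _))
    refine setIntegral_congr_fun measurableSet_Ici fun x hx => ?_
    rw [Set.indicator_of_mem hx, norm_sub_rev]
  have hsub : Integrable (fun s : ℝ≥0 => g s - φ s) leb := hgi'.sub hφ
  have hprim : ∀ s : Set ℝ≥0, ‖∫ r in s, g r ∂leb - ∫ r in s, φ r ∂leb‖ ≤ δ := fun s => by
    rw [← integral_sub hgi'.integrableOn hφ.integrableOn]
    exact (norm_setIntegral_le_integral_norm hsub s).trans hdist
  have hgeq : ∫ s : ℝ≥0, g s * Complex.exp (∫ r in Set.Iio s, g r ∂leb) ∂leb =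
      Complex.exp (∫ s : ℝ≥0, g s ∂leb) - 1 := by
    have h1 := integral_mul_exp_of_continuous hgc hgi
    rw [← integral_leb, ← integral_leb] at h1
    simpa only [setIntegral_Iio_leb] using h1
  have hb1 : ‖Complex.exp (∫ s : ℝ≥0, g s ∂leb) - Complex.exp (∫ s, φ s ∂leb)‖ ≤
      Real.exp C * (2 * δ) := by
    refine norm_exp_sub_exp_le (norm_integral_le_integral_norm _) ?_ hδ1
    simpa using hprim Set.univ
  have hb2 : ‖(∫ s : ℝ≥0, g s * Complex.exp (∫ r in Set.Iio s, g r ∂leb) ∂leb) -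
      ∫ s, φ s * Complex.exp (∫ r in Set.Iio s, φ r ∂leb) ∂leb‖ ≤
      δ * Real.exp (C + 1) + C * (Real.exp C * (2 * δ)) := by
    rw [← integral_sub (integrable_mul_exp hgi') (integrable_mul_exp hφ)]
    refine (norm_integral_le_integral_norm _).trans ?_
    have hbd : ∀ s : ℝ≥0, ‖g s * Complex.exp (∫ r in Set.Iio s, g r ∂leb) -
        φ s * Complex.exp (∫ r in Set.Iio s, φ r ∂leb)‖ ≤
        ‖g s - φ s‖ * Real.exp (C + 1) + ‖φ s‖ * (Real.exp C * (2 * δ)) := by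
      intro s
      have : g s * Complex.exp (∫ r in Set.Iio s, g r ∂leb) -
        φ s * Complex.exp (∫ r in Set.Iio s, φ r ∂leb) =
          (g s - φ s) * Complex.exp (∫ r in Set.Iio s, g r ∂leb) +
          φ s * (Complex.exp (∫ r in Set.Iio s, g r ∂leb) -
            Complex.exp (∫ r in Set.Iio s, φ r ∂leb)) := by ring
      rw [this]
      refine (norm_add_le _ _).trans ?_
      rw [norm_mul, norm_mul]
      gcongr
      · rw [Complex.norm_exp]
        refine Real.exp_le_exp.2 ((Complex.re_le_norm _).trans ?_)
        have h1 := norm_setIntegral_le_integral_norm hφ (Set.Iio s)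
        have h2 := hprim (Set.Iio s)
        have h3 := norm_le_norm_add_norm_sub' (∫ r in Set.Iio s, g r ∂leb)
          (∫ r in Set.Iio s, φ r ∂leb)
        linarith
      · exact norm_exp_sub_exp_le (norm_setIntegral_le_integral_norm hφ _) (hprim _) hδ1
    refine (integral_mono_of_nonneg (Filter.Eventually.of_forall fun _ => norm_nonneg _)
      ((hsub.norm.mul_const _).add (hφ.norm.mul_const _))
      (Filter.Eventually.of_forall hbd)).trans ?_
    simp only [Pi.add_apply]
    rw [integral_add (hsub.norm.mul_const _) (hφ.norm.mul_const _), integral_mul_const,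
      integral_mul_const]
    gcongr
  rw [hgeq] at hb2
  have h3 : ∀ a b c : ℂ, ‖a - (b - 1)‖ ≤ ‖(c - 1) - a‖ + ‖c - b‖ := fun a b c => by
    have : a - (b - 1) = (c - b) - ((c - 1) - a) := by ring
    rw [this, add_comm]
    exact norm_sub_le _ _
  refine (h3 _ _ _).trans ((add_le_add hb2 hb1).trans (le_trans (le_of_eq ?_) hδε))
  rw [hK]; ring

end Leb

/-! ### Exponential vectors and truncation -/

section Fock

/-- Expand ‖x a − x b‖² into inner products. Both exponential vectors and truncations are known only
through their kernels, and this turns kernel continuity into norm continuity. -/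
theorem continuous_of_continuous_inner {X E : Type*} [TopologicalSpace X] [NormedAddCommGroup E]
    [InnerProductSpace ℂ E] {x : X → E}
    (h1 : Continuous fun a => (inner ℂ (x a) (x a) : ℂ))
    (h2 : ∀ b, Continuous fun a => (inner ℂ (x a) (x b) : ℂ)) : Continuous x := by
  refine continuous_iff_continuousAt.2 fun b => tendsto_iff_norm_sub_tendsto_zero.2 ?_
  have h3 : ∀ a, ‖x a - x b‖ = √(Complex.re (inner ℂ (x a) (x a) - inner ℂ (x a) (x b) -
      (starRingEnd ℂ) (inner ℂ (x a) (x b)) + inner ℂ (x b) (x b))) := fun a => by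
    rw [norm_eq_sqrt_re_inner (𝕜 := ℂ), inner_sub_left, inner_sub_right, inner_sub_right,
      inner_conj_symm, RCLike.re_eq_complex_re]
    congr 2
    ring
  simp_rw [h3]
  have hc : Continuous fun a => √(Complex.re (inner ℂ (x a) (x a) - inner ℂ (x a) (x b) -
      (starRingEnd ℂ) (inner ℂ (x a) (x b)) + inner ℂ (x b) (x b))) :=
    Real.continuous_sqrt.comp (Complex.continuous_re.comp (((h1.sub (h2 b)).sub
      (Complex.continuous_conj.comp (h2 b))).add continuous_const))
  have := hc.tendsto b
  simpa using this

theorem continuous_expVec {V : Type*} [NormedAddCommGroup V] [InnerProductSpace ℂ V] :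
    Continuous (expVec : V → FockOver V) := by
  refine continuous_of_continuous_inner ?_ fun g => ?_ <;> simp only [inner_expVec] <;> fun_prop

instance {V : Type*} [NormedAddCommGroup V] [InnerProductSpace ℂ V]
    [TopologicalSpace.SeparableSpace V] : TopologicalSpace.SeparableSpace (FockOver V) := by
  have h := ((TopologicalSpace.isSeparable_range (continuous_expVec (V := V))).span
    (R := ℂ)).closure
  rw [← TopologicalSpace.isSeparable_univ_iff]
  refine h.mono fun z _ => ?_
  have : z ∈ (Submodule.span ℂ (Set.range (expVec : V → FockOver V))).topologicalClosure :=
    span_expVec_dense (V := V) ▸ Submodule.mem_top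
  exact this

variable {𝔥 𝔨 : Type*}
  [NormedAddCommGroup 𝔥] [InnerProductSpace ℂ 𝔥]
  [NormedAddCommGroup 𝔨] [InnerProductSpace ℂ 𝔨]

instance [TopologicalSpace.SeparableSpace 𝔨] :
    TopologicalSpace.SeparableSpace (NoiseL2 𝔨) := by
  have : Fact ((2 : ℝ≥0∞) ≠ ∞) := ⟨by simp⟩
  infer_instance

/-- The truncation `1_{[0,t)} f`. -/
def trunc (t : ℝ≥0) (f : NoiseL2 𝔨) : NoiseL2 𝔨 :=
  ((Lp.memLp f).indicator (measurableSet_Iio (a := t))).toLp _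

theorem coeFn_trunc (t : ℝ≥0) (f : NoiseL2 𝔨) :
    trunc t f =ᵐ[leb] (Set.Iio t).indicator f := MemLp.coeFn_toLp _

theorem fockVacProj_expVec_trunc (t : ℝ≥0) (f : NoiseL2 𝔨) :
    fockVacProj 𝔨 t (expVec f) = expVec (trunc t f) :=
  fockVacProj_expVec 𝔨 t f _ (coeFn_trunc t f)

theorem integrable_inner_noise (f g : NoiseL2 𝔨) :
    Integrable (fun s => (inner ℂ (f s) (g s) : ℂ)) leb := L2.integrable_inner f g

theorem inner_trunc_trunc (s t : ℝ≥0) (f g : NoiseL2 𝔨) :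
    (inner ℂ (trunc s f) (trunc t g) : ℂ) = ∫ r in Set.Iio (min s t), inner ℂ (f r) (g r) ∂leb := by
  rw [L2.inner_def, ← integral_indicator measurableSet_Iio]
  refine integral_congr_ae ?_
  filter_upwards [coeFn_trunc s f, coeFn_trunc t g] with r h1 h2
  rw [h1, h2]
  by_cases hs : r < s <;> by_cases ht : r < t <;> simp [Set.indicator, hs, ht]

theorem continuous_trunc (f : NoiseL2 𝔨) : Continuous fun t => trunc t f := by
  have h := continuous_setIntegral_Iio (integrable_inner_noise f f)
  refine continuous_of_continuous_inner ?_ fun t => ?_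
  · simp only [inner_trunc_trunc, min_self]
    exact h
  · simp only [inner_trunc_trunc]
    exact h.comp (continuous_id.min continuous_const)

theorem fockVacProj_comp_of_le {s t : ℝ≥0} (h : s ≤ t) :
    fockVacProj 𝔨 s ∘L fockVacProj 𝔨 t = fockVacProj 𝔨 s := by
  refine Submodule.starProjection_comp_starProjection_of_le
    (Submodule.topologicalClosure_mono (Submodule.span_mono ?_))
  rintro _ ⟨f, hf, rfl⟩
  exact ⟨f, hf.mono fun r hr hrt => hr (h.trans hrt), rfl⟩

theorem fockVacProj_adjoint (t : ℝ≥0) : (fockVacProj 𝔨 t).adjoint = fockVacProj 𝔨 t :=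
  isSelfAdjoint_starProjection _

theorem norm_fockVacProj_apply_le (t : ℝ≥0) (x : Fock 𝔨) : ‖fockVacProj 𝔨 t x‖ ≤ ‖x‖ :=
  Submodule.norm_starProjection_apply_le _ x

theorem vacProj_tmul (t : ℝ≥0) (u : 𝔥) (x : Fock 𝔨) :
    vacProj 𝔥 𝔨 t (tmul u x) = tmul u (fockVacProj 𝔨 t x) := opTensor_tmul _ _ _ _

theorem vacProj_comp_of_le {s t : ℝ≥0} (h : s ≤ t) :
    vacProj 𝔥 𝔨 s ∘L vacProj 𝔥 𝔨 t = vacProj 𝔥 𝔨 s := by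
  rw [vacProj, vacProj, opTensor_comp, fockVacProj_comp_of_le h, ContinuousLinearMap.id_comp]

theorem vacProj_adjoint [CompleteSpace 𝔥] (t : ℝ≥0) :
    (vacProj 𝔥 𝔨 t).adjoint = vacProj 𝔥 𝔨 t := by
  rw [vacProj, opTensor_adjoint, fockVacProj_adjoint, ContinuousLinearMap.adjoint_id]

theorem vacProj_comp_of_ge [CompleteSpace 𝔥] {s t : ℝ≥0} (h : s ≤ t) :
    vacProj 𝔥 𝔨 t ∘L vacProj 𝔥 𝔨 s = vacProj 𝔥 𝔨 s := by
  have := congrArg ContinuousLinearMap.adjoint (vacProj_comp_of_le (𝔥 := 𝔥) (𝔨 := 𝔨) h)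
  simpa only [ContinuousLinearMap.adjoint_comp, vacProj_adjoint] using this

/-- A closed subspace containing all `u ⊗ ε(f)` is everything. -/
theorem mem_of_tmul_expVec_mem (W : Submodule ℂ (InitFock 𝔥 𝔨))
    (hW : IsClosed (W : Set (InitFock 𝔥 𝔨))) (h : ∀ (u : 𝔥) (f : NoiseL2 𝔨), tmul u (expVec f) ∈ W)
    (z : InitFock 𝔥 𝔨) : z ∈ W := by
  refine tmul_mem_closed (span_univ_closure 𝔥) (span_expVec_dense (V := NoiseL2 𝔨)) W hW ?_ z
  rintro u - _ ⟨f, rfl⟩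
  exact h u f

theorem ext_inner_tmul_expVec {x y : InitFock 𝔥 𝔨}
    (h : ∀ (u : 𝔥) (f : NoiseL2 𝔨), (inner ℂ (tmul u (expVec f)) x : ℂ) =
      inner ℂ (tmul u (expVec f)) y) : x = y := by
  refine ext_inner_left ℂ fun z => ?_
  have := mem_of_tmul_expVec_mem (innerSL ℂ (x - y)).ker (ContinuousLinearMap.isClosed_ker _)
    (fun u f => ?_) z
  · have h2 : (inner ℂ (x - y) z : ℂ) = 0 := this
    rw [← sub_eq_zero, ← inner_sub_right, ← inner_conj_symm, h2, map_zero]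
  · change (inner ℂ (x - y) (tmul u (expVec f)) : ℂ) = 0
    rw [← inner_conj_symm, inner_sub_right, h, sub_self, map_zero]

theorem ext_tmul_expVec {K : Type*} [NormedAddCommGroup K] [NormedSpace ℂ K]
    {S T : InitFock 𝔥 𝔨 →L[ℂ] K}
    (h : ∀ (u : 𝔥) (f : NoiseL2 𝔨), S (tmul u (expVec f)) = T (tmul u (expVec f))) : S = T := by
  ext z
  have := mem_of_tmul_expVec_mem (S - T).ker (S - T).isClosed_ker (fun u f => by simp [h]) z
  simpa [sub_eq_zero] using this

end Fock

/-! ### The adapted gradient -/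

section Gradient

variable {𝔥 𝔨 : Type*}
  [NormedAddCommGroup 𝔥] [InnerProductSpace ℂ 𝔥]
  [NormedAddCommGroup 𝔨] [InnerProductSpace ℂ 𝔨]

/-- The value at `s` of the adapted gradient of `u ⊗ ε(f)`. -/
def gradFun (f : NoiseL2 𝔨) (u : 𝔥) (s : ℝ≥0) : HTensor 𝔨 (InitFock 𝔥 𝔨) :=
  tmul (f s) (tmul u (expVec (trunc s f)))

/-- ε(1_{[0,s)} f) is an orthogonal projection of ε(f), so the gradient is dominated by a multiple
of ‖f(s)‖ and hence square integrable. -/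
theorem norm_gradFun_le (f : NoiseL2 𝔨) (u : 𝔥) (s : ℝ≥0) :
    ‖gradFun f u s‖ ≤ ‖tmul u (expVec f)‖ * ‖f s‖ := by
  rw [gradFun, norm_tmul, mul_comm, norm_tmul, norm_tmul, ← fockVacProj_expVec_trunc]
  gcongr
  exact norm_fockVacProj_apply_le _ _

theorem memLp_gradFun (f : NoiseL2 𝔨) (u : 𝔥) : MemLp (gradFun f u) 2 leb := by
  refine (Lp.memLp f).of_le_mul (c := ‖tmul u (expVec f)‖) ?_
    (Filter.Eventually.of_forall (norm_gradFun_le f u))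
  have h1 : Continuous fun s => tmul u (expVec (trunc s f)) :=
    (tmulL 𝔥 (Fock 𝔨) u).continuous.comp (continuous_expVec.comp (continuous_trunc f))
  have h2 : Continuous fun q : 𝔨 × InitFock 𝔥 𝔨 => tmul q.1 q.2 :=
    (tmulL 𝔨 (InitFock 𝔥 𝔨)).continuous₂
  exact h2.comp_aestronglyMeasurable (g := fun q : 𝔨 × InitFock 𝔥 𝔨 => tmul q.1 q.2)
    (f := fun s => (f s, tmul u (expVec (trunc s f))))
    ((Lp.aestronglyMeasurable f).prodMk h1.aestronglyMeasurable)

/-- The adapted gradient of `u ⊗ ε(f)`. -/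
def gradExp (p : NoiseL2 𝔨 × 𝔥) : Lp (HTensor 𝔨 (InitFock 𝔥 𝔨)) 2 leb :=
  (memLp_gradFun p.1 p.2).toLp _

/-- The truncated kernel exp(∫_0^s ⟨f,g⟩) times ⟨f(s), g(s)⟩ is the derivative of that kernel. The
boundary term at s = 0 is the contribution of the vacuum ε(0). -/
theorem inner_gradExp (p q : NoiseL2 𝔨 × 𝔥) :
    (inner ℂ (gradExp p) (gradExp q) : ℂ) =
      inner ℂ (tmul p.2 (expVec p.1)) (tmul q.2 (expVec q.1)) -
      inner ℂ (tmul p.2 (expVec (0 : NoiseL2 𝔨))) (tmul q.2 (expVec (0 : NoiseL2 𝔨))) := by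
  rw [L2.inner_def]
  have h1 : ∫ s, (inner ℂ (gradExp p s) (gradExp q s) : ℂ) ∂leb =
      ∫ s, inner ℂ p.2 q.2 * ((inner ℂ (p.1 s) (q.1 s) : ℂ) *
        Complex.exp (∫ r in Set.Iio s, inner ℂ (p.1 r) (q.1 r) ∂leb)) ∂leb := by
    refine integral_congr_ae ?_
    filter_upwards [(memLp_gradFun p.1 p.2).coeFn_toLp, (memLp_gradFun q.1 q.2).coeFn_toLp]
      with s hp hq
    rw [gradExp, gradExp, hp, hq, gradFun, gradFun, inner_tmul, inner_tmul, inner_expVec,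
      inner_trunc_trunc, min_self]
    ring
  rw [h1, integral_const_mul, integral_mul_exp (integrable_inner_noise p.1 q.1), inner_tmul,
    inner_tmul, inner_expVec, inner_expVec, inner_zero_left, Complex.exp_zero, L2.inner_def]
  ring

/-- The linear combination of the vectors `u ⊗ ε(f)`. -/
abbrev expComb (𝔥 𝔨 : Type*) [NormedAddCommGroup 𝔥] [InnerProductSpace ℂ 𝔥]
    [NormedAddCommGroup 𝔨] [InnerProductSpace ℂ 𝔨] :
    (NoiseL2 𝔨 × 𝔥 →₀ ℂ) →ₗ[ℂ] InitFock 𝔥 𝔨 :=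
  Finsupp.linearCombination ℂ fun p => tmul p.2 (expVec p.1)

/-- The linear combination of the adapted gradients of the vectors `u ⊗ ε(f)`. -/
abbrev gradComb (𝔥 𝔨 : Type*) [NormedAddCommGroup 𝔥] [InnerProductSpace ℂ 𝔥]
    [NormedAddCommGroup 𝔨] [InnerProductSpace ℂ 𝔨] :
    (NoiseL2 𝔨 × 𝔥 →₀ ℂ) →ₗ[ℂ] Lp (HTensor 𝔨 (InitFock 𝔥 𝔨)) 2 leb :=
  Finsupp.linearCombination ℂ gradExp

theorem denseRange_expComb : DenseRange (expComb 𝔥 𝔨) := by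
  intro z
  have h := mem_of_tmul_expVec_mem (LinearMap.range (expComb 𝔥 𝔨)).topologicalClosure
    (Submodule.isClosed_topologicalClosure _)
    (fun u f => Submodule.le_topologicalClosure _ ⟨Finsupp.single (f, u) 1, by simp⟩) z
  exact h

theorem inner_linearCombination {ι E : Type*} [NormedAddCommGroup E] [InnerProductSpace ℂ E]
    (x : ι → E) (c : ι →₀ ℂ) :
    (inner ℂ (Finsupp.linearCombination ℂ x c) (Finsupp.linearCombination ℂ x c) : ℂ) =
      ∑ i ∈ c.support, ∑ j ∈ c.support, (starRingEnd ℂ) (c i) * c j * inner ℂ (x i) (x j) := by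
  simp only [Finsupp.linearCombination_apply, Finsupp.sum, sum_inner]
  refine Finset.sum_congr rfl fun i _ => ?_
  rw [inner_sum]
  refine Finset.sum_congr rfl fun j _ => ?_
  rw [inner_smul_left, inner_smul_right, mul_assoc]

/-- The Gram matrix of the gradients is that of the vectors u ⊗ ε(f) minus that of their vacuum
parts u ⊗ ε(0), and the subtracted quadratic form is nonnegative. The inequality also makes the
extension to the whole space well defined. -/
theorem norm_gradComb_le (c : NoiseL2 𝔨 × 𝔥 →₀ ℂ) :
    ‖gradComb 𝔥 𝔨 c‖ ≤ 1 * ‖expComb 𝔥 𝔨 c‖ := by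
  have h : (inner ℂ (gradComb 𝔥 𝔨 c) (gradComb 𝔥 𝔨 c) : ℂ) =
      inner ℂ (expComb 𝔥 𝔨 c) (expComb 𝔥 𝔨 c) -
      inner ℂ (Finsupp.linearCombination ℂ
        (fun p : NoiseL2 𝔨 × 𝔥 => tmul p.2 (expVec (0 : NoiseL2 𝔨))) c)
        (Finsupp.linearCombination ℂ
        (fun p : NoiseL2 𝔨 × 𝔥 => tmul p.2 (expVec (0 : NoiseL2 𝔨))) c) := by
    rw [inner_linearCombination, inner_linearCombination, inner_linearCombination]
    simp only [inner_gradExp, mul_sub, Finset.sum_sub_distrib]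
  simp only [inner_self_eq_norm_sq_to_K] at h
  have h2 : ‖gradComb 𝔥 𝔨 c‖ ^ 2 = ‖expComb 𝔥 𝔨 c‖ ^ 2 - ‖Finsupp.linearCombination ℂ
        (fun p : NoiseL2 𝔨 × 𝔥 => tmul p.2 (expVec (0 : NoiseL2 𝔨))) c‖ ^ 2 := by
    exact_mod_cast h
  rw [one_mul]
  refine (sq_le_sq₀ (norm_nonneg _) (norm_nonneg _)).1 ?_
  rw [h2]
  linarith [sq_nonneg ‖Finsupp.linearCombination ℂ
        (fun p : NoiseL2 𝔨 × 𝔥 => tmul p.2 (expVec (0 : NoiseL2 𝔨))) c‖]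

/-- The adapted gradient, a contraction of `h ⊗ F` into `L²(ℝ₊; k ⊗ h ⊗ F)` with
`u ⊗ ε(f) ↦ (s ↦ f(s) ⊗ u ⊗ ε(1_{[0,s)} f))`. -/
def grad (𝔥 𝔨 : Type*) [NormedAddCommGroup 𝔥] [InnerProductSpace ℂ 𝔥]
    [NormedAddCommGroup 𝔨] [InnerProductSpace ℂ 𝔨] :
    InitFock 𝔥 𝔨 →L[ℂ] Lp (HTensor 𝔨 (InitFock 𝔥 𝔨)) 2 leb :=
  (gradComb 𝔥 𝔨).extendOfNorm (expComb 𝔥 𝔨)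

theorem grad_tmul_expVec (u : 𝔥) (f : NoiseL2 𝔨) :
    grad 𝔥 𝔨 (tmul u (expVec f)) = gradExp (f, u) := by
  have := (gradComb 𝔥 𝔨).extendOfNorm_eq denseRange_expComb ⟨1, norm_gradComb_le⟩
    (Finsupp.single (f, u) 1)
  simpa [grad] using this

theorem norm_grad_le : ‖grad 𝔥 𝔨‖ ≤ 1 :=
  LinearMap.opNorm_extendOfNorm_le denseRange_expComb zero_le_one norm_gradComb_le

end Gradient

/-! ### Multiplication by an operator-valued function -/

section OpLp

variable {α E F : Type*} [MeasurableSpace α] {μ : Measure α} {p : ℝ≥0∞}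
  [NormedAddCommGroup E] [InnerProductSpace ℂ E]
  [NormedAddCommGroup F] [InnerProductSpace ℂ F] [TopologicalSpace.SeparableSpace F]

theorem WeakMeas.memLp {T : α → E →L[ℂ] F} (hT : WeakMeas T)
    (hN : MemLp (fun a => ‖T a‖) p μ) (x : E) : MemLp (fun a => T a x) p μ := by
  refine hN.of_le_mul (c := ‖x‖) (hT.apply x).aestronglyMeasurable
    (Filter.Eventually.of_forall fun a => ?_)
  rw [norm_norm, mul_comm]
  exact (T a).le_opNorm x

/-- The operator `x ↦ (a ↦ T a x)` into `L^p`. -/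
def opLp [Fact (1 ≤ p)] (T : α → E →L[ℂ] F) (hT : WeakMeas T)
    (hN : MemLp (fun a => ‖T a‖) p μ) : E →L[ℂ] Lp F p μ :=
  LinearMap.mkContinuous
    { toFun := fun x => (hT.memLp hN x).toLp _
      map_add' := fun x y => by
        rw [← MemLp.toLp_add]
        simp only [map_add]
        rfl
      map_smul' := fun c x => by
        rw [RingHom.id_apply, ← MemLp.toLp_const_smul]
        simp only [map_smul]
        rfl }
    (eLpNorm (fun a => ‖T a‖) p μ).toReal fun x => by
      change ‖(hT.memLp hN x).toLp _‖ ≤ _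
      rw [Lp.norm_toLp]
      have h := eLpNorm_le_mul_eLpNorm_of_ae_le_mul (f := fun a => T a x) (g := fun a => ‖T a‖)
        (μ := μ) (c := ‖x‖) (Filter.Eventually.of_forall fun a => by
          rw [norm_norm, mul_comm]; exact (T a).le_opNorm x) p
      refine (ENNReal.toReal_mono (ENNReal.mul_ne_top ENNReal.ofReal_ne_top hN.2.ne) h).trans ?_
      rw [ENNReal.toReal_mul, ENNReal.toReal_ofReal (norm_nonneg _), mul_comm]

theorem coeFn_opLp [Fact (1 ≤ p)] (T : α → E →L[ℂ] F) (hT : WeakMeas T)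
    (hN : MemLp (fun a => ‖T a‖) p μ) (x : E) : opLp T hT hN x =ᵐ[μ] fun a => T a x :=
  (hT.memLp hN x).coeFn_toLp

theorem norm_opLp_le [Fact (1 ≤ p)] (T : α → E →L[ℂ] F) (hT : WeakMeas T)
    (hN : MemLp (fun a => ‖T a‖) p μ) :
    ‖opLp T hT hN‖ ≤ (eLpNorm (fun a => ‖T a‖) p μ).toReal :=
  LinearMap.mkContinuous_norm_le _ ENNReal.toReal_nonneg _

end OpLp

/-! ### Integrals of columns -/

section Column

variable {𝔥 𝔨 : Type*}
  [NormedAddCommGroup 𝔥] [InnerProductSpace ℂ 𝔥]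
  [NormedAddCommGroup 𝔨] [InnerProductSpace ℂ 𝔨]

theorem hat_eq (c : 𝔨) : hat c = hat 0 + hatIncl 𝔨 c := by
  apply WithLp.ofLp_injective
  simp [hat, hatIncl]

theorem inclTime_apply (ξ : InitFock 𝔥 𝔨) :
    inclTime ξ = tmul (hat (0 : 𝔨)) ξ := rfl

theorem inclNoise_tmul (c : 𝔨) (ξ : InitFock 𝔥 𝔨) :
    inclNoise (tmul c ξ) = tmul (hatIncl 𝔨 c) ξ := opTensor_tmul _ _ _ _

theorem ampl_tmul (T : InitFock 𝔥 𝔨 →L[ℂ] InitFock 𝔥 𝔨) (c : Hat 𝔨) (ξ : InitFock 𝔥 𝔨) :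
    ampl T (tmul c ξ) = tmul c (T ξ) := opTensor_tmul _ _ _ _

theorem ampl_comp (S T : InitFock 𝔥 𝔨 →L[ℂ] InitFock 𝔥 𝔨) :
    ampl (S ∘L T) = ampl S ∘L ampl T := by
  rw [ampl, ampl, ampl, opTensor_comp, ContinuousLinearMap.id_comp]

theorem ampl_adjoint [CompleteSpace 𝔥] [CompleteSpace 𝔨]
    (T : InitFock 𝔥 𝔨 →L[ℂ] InitFock 𝔥 𝔨) : (ampl T).adjoint = ampl T.adjoint := by
  rw [ampl, ampl, opTensor_adjoint, ContinuousLinearMap.adjoint_id]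

theorem ampl_comp_inclTime (T : InitFock 𝔥 𝔨 →L[ℂ] InitFock 𝔥 𝔨) :
    ampl T ∘L inclTime = inclTime ∘L T := by
  ext ξ
  simp [inclTime_apply, ampl_tmul]

/-- The block `k` of a column. -/
abbrev colK [CompleteSpace 𝔥] [CompleteSpace 𝔨]
    (R : ℝ≥0 → InitFock 𝔥 𝔨 →L[ℂ] HatInitFock 𝔥 𝔨) (s : ℝ≥0) :
    InitFock 𝔥 𝔨 →L[ℂ] InitFock 𝔥 𝔨 :=
  (inclTime).adjoint ∘L R s

/-- The block `l` of a column. -/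
abbrev colL [CompleteSpace 𝔥] [CompleteSpace 𝔨]
    (R : ℝ≥0 → InitFock 𝔥 𝔨 →L[ℂ] HatInitFock 𝔥 𝔨) (s : ℝ≥0) :
    InitFock 𝔥 𝔨 →L[ℂ] HTensor 𝔨 (InitFock 𝔥 𝔨) :=
  (inclNoise).adjoint ∘L R s

theorem inner_hat_tmul [CompleteSpace 𝔥] [CompleteSpace 𝔨] (c : 𝔨) (ξ : InitFock 𝔥 𝔨)
    (η : HatInitFock 𝔥 𝔨) :
    (inner ℂ (tmul (hat c) ξ) η : ℂ) =
      inner ℂ ξ ((inclTime).adjoint η) + inner ℂ (tmul c ξ) ((inclNoise).adjoint η) := by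
  rw [ContinuousLinearMap.adjoint_inner_right, ContinuousLinearMap.adjoint_inner_right,
    inclTime_apply, inclNoise_tmul, ← inner_add_left, ← tmul_add_left, ← hat_eq]

variable [CompleteSpace 𝔥] [CompleteSpace 𝔨]

/-- The conditions under which the column `R` has an integral over `S`. -/
structure ColIntegrable (S : Set ℝ≥0) (R : ℝ≥0 → InitFock 𝔥 𝔨 →L[ℂ] HatInitFock 𝔥 𝔨) :
    Prop where
  meas : WeakMeas R
  adapted : ∀ s, ampl (vacProj 𝔥 𝔨 s) ∘L R s = R s
  memK : MemLp (fun s => ‖colK R s‖) 1 (leb.restrict S)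
  memL : MemLp (fun s => ‖colL R s‖) 2 (leb.restrict S)

/-- `Y` is the integral of the column `R` over `S`, tested on `u ⊗ ε(f)` and arbitrary vectors. -/
def IsColInt (S : Set ℝ≥0) (R : ℝ≥0 → InitFock 𝔥 𝔨 →L[ℂ] HatInitFock 𝔥 𝔨)
    (Y : InitFock 𝔥 𝔨 →L[ℂ] InitFock 𝔥 𝔨) : Prop :=
  ∀ (u : 𝔥) (f : NoiseL2 𝔨) (ζ : InitFock 𝔥 𝔨),
    (inner ℂ (tmul u (expVec f)) (Y ζ) : ℂ) =
      ∫ s in S, inner ℂ (tmul (hat (f s)) (tmul u (expVec f))) (R s ζ) ∂leb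

/-- `Y` is the integral of the column `R` over `S`, tested on vectors `u ⊗ ε(f)`. -/
def IsColIntExp (S : Set ℝ≥0) (R : ℝ≥0 → InitFock 𝔥 𝔨 →L[ℂ] HatInitFock 𝔥 𝔨)
    (Y : InitFock 𝔥 𝔨 →L[ℂ] InitFock 𝔥 𝔨) : Prop :=
  ∀ (u v : 𝔥) (f g : NoiseL2 𝔨),
    (inner ℂ (tmul u (expVec f)) (Y (tmul v (expVec g))) : ℂ) =
      ∫ s in S, inner ℂ (tmul (hat (f s)) (tmul u (expVec f))) (R s (tmul v (expVec g))) ∂leb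

variable {S : Set ℝ≥0} {R R' : ℝ≥0 → InitFock 𝔥 𝔨 →L[ℂ] HatInitFock 𝔥 𝔨}
  {Y Y' : InitFock 𝔥 𝔨 →L[ℂ] InitFock 𝔥 𝔨}

theorem IsColIntExp.unique (h : IsColIntExp S R Y) (h' : IsColIntExp S R Y') : Y = Y' :=
  ext_tmul_expVec fun v g => ext_inner_tmul_expVec fun u f => by rw [h, h']

theorem IsColInt.toExp (h : IsColInt S R Y) : IsColIntExp S R Y := fun u _ f _ => h u f _

/-- Since R_s = (I ⊗ P_s) R_s, the projection can be moved to the test vector, where it truncates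
ε(f) at s. This identifies the l-part of the integral with the adjoint of the adapted gradient. -/
theorem inner_gradFun (hR : ∀ s, ampl (vacProj 𝔥 𝔨 s) ∘L R s = R s) (u : 𝔥) (f : NoiseL2 𝔨)
    (s : ℝ≥0) (ζ : InitFock 𝔥 𝔨) :
    (inner ℂ (gradFun f u s) (colL R s ζ) : ℂ) =
      inner ℂ (tmul (f s) (tmul u (expVec f))) (colL R s ζ) := by
  rw [gradFun, ContinuousLinearMap.comp_apply, ContinuousLinearMap.adjoint_inner_right,
    ContinuousLinearMap.adjoint_inner_right, inclNoise_tmul, inclNoise_tmul,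
    ← fockVacProj_expVec_trunc, ← vacProj_tmul, ← ampl_tmul]
  conv_rhs => rw [← hR s]
  rw [ContinuousLinearMap.comp_apply, ← ContinuousLinearMap.adjoint_inner_left (ampl _),
    ampl_adjoint, vacProj_adjoint]

variable [TopologicalSpace.SeparableSpace 𝔥] [TopologicalSpace.SeparableSpace 𝔨]

theorem ColIntegrable.integrable_time (hR : ColIntegrable S R) (ξ ζ : InitFock 𝔥 𝔨) :
    Integrable (fun s => (inner ℂ ξ (colK R s ζ) : ℂ)) (leb.restrict S) :=
  (memLp_one_iff_integrable.1 ((hR.meas.comp_const_left _).memLp hR.memK ζ)).const_inner ξ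

theorem ColIntegrable.integrable_noise (hR : ColIntegrable S R) (u : 𝔥) (f : NoiseL2 𝔨)
    (ζ : InitFock 𝔥 𝔨) :
    Integrable (fun s => (inner ℂ (tmul (f s) (tmul u (expVec f))) (colL R s ζ) : ℂ))
      (leb.restrict S) := by
  simp only [← inner_gradFun hR.adapted]
  have h1 := (memLp_gradFun f u).restrict S
  have h2 := (hR.meas.comp_const_left (inclNoise).adjoint).memLp hR.memL ζ
  refine (L2.integrable_inner (𝕜 := ℂ) h1.toLp h2.toLp).congr ?_
  filter_upwards [h1.coeFn_toLp, h2.coeFn_toLp] with s hs1 hs2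
  rw [hs1, hs2]

theorem ColIntegrable.integrable (hR : ColIntegrable S R) (u : 𝔥) (f : NoiseL2 𝔨)
    (ζ : InitFock 𝔥 𝔨) :
    Integrable (fun s => (inner ℂ (tmul (hat (f s)) (tmul u (expVec f))) (R s ζ) : ℂ))
      (leb.restrict S) := by
  simp only [inner_hat_tmul]
  exact (hR.integrable_time _ ζ).add (hR.integrable_noise u f ζ)

theorem WeakMeas.indicator {α E F : Type*} [MeasurableSpace α]
    [NormedAddCommGroup E] [InnerProductSpace ℂ E]
    [NormedAddCommGroup F] [InnerProductSpace ℂ F] {T : α → E →L[ℂ] F} (hT : WeakMeas T)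
    {S : Set α} (hS : MeasurableSet S) : WeakMeas (S.indicator T) := fun y x => by
  have : (fun a => (inner ℂ y (S.indicator T a x) : ℂ)) =
      S.indicator fun a => (inner ℂ y (T a x) : ℂ) := by
    ext a
    by_cases ha : a ∈ S <;> simp [ha]
  rw [this]
  exact (hT y x).indicator hS

theorem norm_indicator_op {α E F : Type*}
    [NormedAddCommGroup E] [InnerProductSpace ℂ E]
    [NormedAddCommGroup F] [InnerProductSpace ℂ F] (T : α → E →L[ℂ] F) (S : Set α) :
    (fun a => ‖S.indicator T a‖) = S.indicator fun a => ‖T a‖ := by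
  ext a
  exact norm_indicator_eq_indicator_norm _ _

/-- Existence of the integral of a column, with the fundamental norm estimate. -/
theorem ColIntegrable.exists_isColInt (hR : ColIntegrable S R) (hS : MeasurableSet S) :
    ∃ Y : InitFock 𝔥 𝔨 →L[ℂ] InitFock 𝔥 𝔨, IsColInt S R Y ∧
      ‖Y‖ ≤ (eLpNorm (fun s => ‖colK R s‖) 1 (leb.restrict S)).toReal +
        (eLpNorm (fun s => ‖colL R s‖) 2 (leb.restrict S)).toReal := by
  have hk : WeakMeas (S.indicator (colK R)) := (hR.meas.comp_const_left _).indicator hS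
  have hl : WeakMeas (S.indicator (colL R)) := (hR.meas.comp_const_left _).indicator hS
  have hk1 : MemLp (fun s => ‖S.indicator (colK R) s‖) 1 leb := by
    rw [norm_indicator_op, memLp_indicator_iff_restrict hS]
    exact hR.memK
  have hl2 : MemLp (fun s => ‖S.indicator (colL R) s‖) 2 leb := by
    rw [norm_indicator_op, memLp_indicator_iff_restrict hS]
    exact hR.memL
  -- The time part is a Bochner integral, a contraction on L¹; the noise part is the adjoint of the
  -- contraction `grad` on L². The two norms in the estimate come from these two terms.
  refine ⟨(L1.integralCLM' ℂ) ∘L opLp _ hk hk1 + (grad 𝔥 𝔨).adjoint ∘L opLp _ hl hl2,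
    fun u f ζ => ?_, ?_⟩
  · have e1 : (inner ℂ (tmul u (expVec f)) (((L1.integralCLM' ℂ) ∘L opLp _ hk hk1) ζ) : ℂ) =
        ∫ s in S, inner ℂ (tmul u (expVec f)) (colK R s ζ) ∂leb := by
      have h1 : ((L1.integralCLM' ℂ) ∘L opLp _ hk hk1) ζ = ∫ s in S, colK R s ζ ∂leb := by
        rw [ContinuousLinearMap.comp_apply, ← L1.integral_eq' ℂ, L1.integral_eq_integral,
          ← integral_indicator hS]
        refine integral_congr_ae ?_
        filter_upwards [coeFn_opLp _ hk hk1 ζ] with s hs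
        rw [hs]
        by_cases hsS : s ∈ S <;> simp [hsS]
      rw [h1, ← integral_inner
        (memLp_one_iff_integrable.1 ((hR.meas.comp_const_left _).memLp hR.memK ζ))]
    have e2 : (inner ℂ (tmul u (expVec f)) (((grad 𝔥 𝔨).adjoint ∘L opLp _ hl hl2) ζ) : ℂ) =
        ∫ s in S, inner ℂ (tmul (f s) (tmul u (expVec f))) (colL R s ζ) ∂leb := by
      rw [ContinuousLinearMap.comp_apply, ContinuousLinearMap.adjoint_inner_right,
        grad_tmul_expVec, L2.inner_def, ← integral_indicator hS]
      refine integral_congr_ae ?_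
      filter_upwards [(memLp_gradFun f u).coeFn_toLp, coeFn_opLp _ hl hl2 ζ] with s hs1 hs2
      rw [gradExp, hs1, hs2]
      by_cases hsS : s ∈ S
      · rw [Set.indicator_of_mem hsS, Set.indicator_of_mem hsS, inner_gradFun hR.adapted]
      · simp [hsS]
    rw [add_apply, inner_add_right, e1, e2, ← integral_add (hR.integrable_time _ ζ)
      (hR.integrable_noise u f ζ)]
    simp only [inner_hat_tmul]
    rfl
  · have n1 := norm_opLp_le _ hk hk1
    have n2 := norm_opLp_le _ hl hl2
    rw [norm_indicator_op, eLpNorm_indicator_eq_eLpNorm_restrict hS] at n1 n2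
    refine (norm_add_le _ _).trans (add_le_add ?_ ?_)
    · refine le_trans (ContinuousLinearMap.opNorm_le_bound _
        (norm_nonneg (opLp _ hk hk1)) fun ζ => ?_) n1
      rw [ContinuousLinearMap.comp_apply, ← L1.integral_eq' ℂ]
      exact (L1.norm_integral_le _).trans (ContinuousLinearMap.le_opNorm _ _)
    · refine (ContinuousLinearMap.opNorm_comp_le _ _).trans ?_
      rw [LinearIsometryEquiv.norm_map]
      calc _ ≤ 1 * ‖opLp _ hl hl2‖ := by gcongr; exact norm_grad_le
        _ ≤ _ := by rw [one_mul]; exact n2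

/-- Matrix elements between exponential vectors determine an operator, so the bound for the
constructed integral holds for any operator with the same matrix elements. -/
theorem ColIntegrable.norm_le (hR : ColIntegrable S R) (hS : MeasurableSet S)
    (h : IsColIntExp S R Y) :
    ‖Y‖ ≤ (eLpNorm (fun s => ‖colK R s‖) 1 (leb.restrict S)).toReal +
        (eLpNorm (fun s => ‖colL R s‖) 2 (leb.restrict S)).toReal := by
  obtain ⟨Z, hZ, hn⟩ := hR.exists_isColInt hS
  rwa [h.unique hZ.toExp]

theorem IsColIntExp.sub (h : IsColIntExp S R Y) (h' : IsColIntExp S R' Y')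
    (hR : ColIntegrable S R) (hR' : ColIntegrable S R') :
    IsColIntExp S (fun s => R s - R' s) (Y - Y') := fun u v f g => by
  simp only [sub_apply, inner_sub_right]
  rw [h, h', integral_sub (hR.integrable u f _) (hR'.integrable u f _)]

theorem IsColIntExp.sdiff {T : Set ℝ≥0} (h : IsColIntExp S R Y) (h' : IsColIntExp T R Y')
    (hR : ColIntegrable S R) (hT : MeasurableSet T) (hTS : T ⊆ S) :
    IsColIntExp (S \ T) R (Y - Y') := fun u v f g => by
  rw [sub_apply, inner_sub_right, h, h', setIntegral_sdiff hT (hR.integrable u f _) hTS]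

theorem ColIntegrable.mono {T : Set ℝ≥0} (hR : ColIntegrable S R) (h : T ⊆ S) :
    ColIntegrable T R :=
  ⟨hR.meas, hR.adapted, hR.memK.mono_measure (Measure.restrict_mono h le_rfl),
    hR.memL.mono_measure (Measure.restrict_mono h le_rfl)⟩

theorem ColIntegrable.sub (hR : ColIntegrable S R) (hR' : ColIntegrable S R') :
    ColIntegrable S (fun s => R s - R' s) := by
  have hm := hR.meas.sub hR'.meas
  refine ⟨hm, fun s => ?_, ?_, ?_⟩
  · rw [ContinuousLinearMap.comp_sub, hR.adapted, hR'.adapted]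
  · refine (hR.memK.add hR'.memK).mono (hm.comp_const_left _).norm.aestronglyMeasurable
      (Filter.Eventually.of_forall fun s => ?_)
    simp only [colK, ContinuousLinearMap.comp_sub, Pi.add_apply, norm_norm]
    exact (norm_sub_le _ _).trans (le_abs_self _)
  · refine (hR.memL.add hR'.memL).mono (hm.comp_const_left _).norm.aestronglyMeasurable
      (Filter.Eventually.of_forall fun s => ?_)
    simp only [colL, ContinuousLinearMap.comp_sub, Pi.add_apply, norm_norm]
    exact (norm_sub_le _ _).trans (le_abs_self _)

end Column

/-! ### Real-valued estimates -/

section Real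

theorem toReal_eLpNorm_one {α : Type*} [MeasurableSpace α] {μ : Measure α} {f : α → ℝ}
    (hf : MemLp f 1 μ) (h0 : ∀ a, 0 ≤ f a) : (eLpNorm f 1 μ).toReal = ∫ a, f a ∂μ := by
  rw [hf.eLpNorm_eq_integral_rpow_norm one_ne_zero ENNReal.one_ne_top, ENNReal.toReal_ofReal]
  · simp [Real.norm_of_nonneg (h0 _)]
  · positivity

theorem toReal_eLpNorm_two {α : Type*} [MeasurableSpace α] {μ : Measure α} {f : α → ℝ}
    (hf : MemLp f 2 μ) : (eLpNorm f 2 μ).toReal = √(∫ a, f a ^ 2 ∂μ) := by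
  rw [hf.eLpNorm_eq_integral_rpow_norm two_ne_zero ENNReal.ofNat_ne_top, ENNReal.toReal_ofReal]
  · simp [Real.sqrt_eq_rpow]
  · positivity

theorem continuous_setIntegral_Iio_of_locally {E : Type*} [NormedAddCommGroup E] [NormedSpace ℝ E]
    {g : ℝ≥0 → E} (hg : ∀ t, IntegrableOn g (Set.Iio t) leb) :
    Continuous fun t => ∫ s in Set.Iio t, g s ∂leb := by
  refine continuous_iff_continuousAt.2 fun t => ?_
  -- Cutting off at t + 1 gives a globally integrable function without changing the primitive near
  -- t.
  have h := continuous_setIntegral_Iio ((hg (t + 1)).integrable_indicator measurableSet_Iio)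
  refine h.continuousAt.congr ?_
  filter_upwards [gt_mem_nhds (lt_add_one t)] with r hr
  refine setIntegral_congr_fun measurableSet_Iio fun s hs => ?_
  rw [Set.indicator_of_mem (Set.mem_Iio.2 (lt_trans hs hr))]

end Real

section Column

variable {𝔥 𝔨 : Type*}
  [NormedAddCommGroup 𝔥] [InnerProductSpace ℂ 𝔥]
  [NormedAddCommGroup 𝔨] [InnerProductSpace ℂ 𝔨]
  [CompleteSpace 𝔥] [CompleteSpace 𝔨]

/-! ### Membership in the algebra and adaptedness -/

theorem norm_expVec_zero : ‖(expVec (0 : NoiseL2 𝔨))‖ = 1 := by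
  rw [← pow_eq_one_iff_of_nonneg (norm_nonneg _) two_ne_zero, norm_sq_eq_re_inner (𝕜 := ℂ),
    inner_expVec, inner_zero_left, Complex.exp_zero]
  simp

theorem ampl_mem_tensorVN {M : VonNeumannAlgebra (InitFock 𝔥 𝔨)}
    {T : InitFock 𝔥 𝔨 →L[ℂ] InitFock 𝔥 𝔨} (hT : T ∈ M) :
    ampl T ∈ tensorVN (fullVN (Hat 𝔨)) M :=
  opTensor_mem_tensorVN (mem_fullVN _) hT

/-- If B commutes with A ⊗ B(F), then I ⊗ B commutes with every generator c ⊗ T of the larger tensor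
product and with its adjoint, hence with the algebra generated. -/
theorem ampl_comm {A : VonNeumannAlgebra 𝔥} {G : HatInitFock 𝔥 𝔨 →L[ℂ] HatInitFock 𝔥 𝔨}
    (hG : G ∈ tensorVN (fullVN (Hat 𝔨)) (tensorVN A (fullVN (Fock 𝔨))))
    {B : InitFock 𝔥 𝔨 →L[ℂ] InitFock 𝔥 𝔨}
    (hB : StarCommutes {T | ∃ a ∈ A, ∃ b ∈ fullVN (Fock 𝔨), T = opTensor a b} B) :
    ampl B ∘L G = G ∘L ampl B := by
  refine mem_generatedVN.1 hG _ ?_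
  rintro _ ⟨c, -, T, hT, rfl⟩
  have h1 := mem_generatedVN.1 hT B hB
  have h2 : T.adjoint ∘L B = B ∘L T.adjoint := by
    have := congrArg ContinuousLinearMap.adjoint (mem_generatedVN.1 hT _ hB.adjoint)
    simpa [ContinuousLinearMap.adjoint_comp] using this
  refine ⟨?_, ?_⟩
  · rw [ampl, opTensor_comp, opTensor_comp, h1, ContinuousLinearMap.id_comp,
      ContinuousLinearMap.comp_id]
  · rw [opTensor_adjoint, ampl, opTensor_comp, opTensor_comp, h2, ContinuousLinearMap.id_comp,
      ContinuousLinearMap.comp_id]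

variable {S : Set ℝ≥0} {R : ℝ≥0 → InitFock 𝔥 𝔨 →L[ℂ] HatInitFock 𝔥 𝔨}
  {Y : InitFock 𝔥 𝔨 →L[ℂ] InitFock 𝔥 𝔨}

/-- Test against B in the commutant. Its adjoint has the form b ⊗ I, so it keeps test vectors of the
form u ⊗ ε(f) with the same f, and I ⊗ B passes through G_s under the integral. Allowing arbitrary
right-hand vectors in `IsColInt` lets the formula be used at both ζ and Bζ. -/
theorem IsColInt.mem {A : VonNeumannAlgebra 𝔥}
    {G : ℝ≥0 → HatInitFock 𝔥 𝔨 →L[ℂ] HatInitFock 𝔥 𝔨}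
    (hG : ∀ s, G s ∈ tensorVN (fullVN (Hat 𝔨)) (tensorVN A (fullVN (Fock 𝔨))))
    (hY : IsColInt S (fun s => G s ∘L inclTime) Y) : Y ∈ tensorVN A (fullVN (Fock 𝔨)) := by
  refine mem_generatedVN.2 fun B hB => ContinuousLinearMap.ext fun ζ => ?_
  obtain ⟨b, hb⟩ := exists_of_starCommutes_tensor_full A _ norm_expVec_zero hB.adjoint
  refine ext_inner_tmul_expVec fun u f => ?_
  rw [ContinuousLinearMap.comp_apply, ContinuousLinearMap.comp_apply,
    ← ContinuousLinearMap.adjoint_inner_left, hb, hY, hY]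
  refine congrArg _ (funext fun s => ?_)
  have h1 : (ampl B ∘L G s) (inclTime ζ) = (G s ∘L ampl B) (inclTime ζ) := by
    rw [ampl_comm (hG s) hB]
  have h2 : ampl B (inclTime ζ) = inclTime (B ζ) :=
    congrArg (fun T => T ζ) (ampl_comp_inclTime (𝔥 := 𝔥) (𝔨 := 𝔨) B)
  simp only [ContinuousLinearMap.comp_apply] at h1 ⊢
  rw [h2] at h1
  rw [← h1, ← ContinuousLinearMap.adjoint_inner_left (ampl B), ampl_adjoint, ampl_tmul, hb]

/-- For s < t, truncating f at t leaves f(s) unchanged for almost every s, and P_t P_s = P_s = P_s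
P_t lets the adapted integrand absorb P_t on both sides. -/
theorem IsColInt.adapted {t : ℝ≥0} (hY : IsColInt (Set.Iio t) R Y)
    (h1 : ∀ s, ampl (vacProj 𝔥 𝔨 s) ∘L R s = R s) (h2 : ∀ s, R s ∘L vacProj 𝔥 𝔨 s = R s) :
    Y = vacProj 𝔥 𝔨 t ∘L Y ∘L vacProj 𝔥 𝔨 t := by
  refine ContinuousLinearMap.ext fun ζ => ext_inner_tmul_expVec fun u f => ?_
  rw [ContinuousLinearMap.comp_apply, ContinuousLinearMap.comp_apply,
    ← ContinuousLinearMap.adjoint_inner_left (vacProj 𝔥 𝔨 t), vacProj_adjoint, vacProj_tmul,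
    fockVacProj_expVec_trunc, hY, hY]
  refine setIntegral_congr_ae measurableSet_Iio ?_
  filter_upwards [coeFn_trunc t f] with s hs hst
  rw [hs, Set.indicator_of_mem hst, ← fockVacProj_expVec_trunc, ← vacProj_tmul, ← ampl_tmul,
    ← ContinuousLinearMap.adjoint_inner_right, ampl_adjoint, vacProj_adjoint]
  have h3 : R s = ampl (vacProj 𝔥 𝔨 t) ∘L R s ∘L vacProj 𝔥 𝔨 t := by
    conv_rhs => rw [← h1 s, ← h2 s]
    have hst' : s ≤ t := le_of_lt hst
    rw [ContinuousLinearMap.comp_assoc, ContinuousLinearMap.comp_assoc,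
      vacProj_comp_of_le hst', ← ContinuousLinearMap.comp_assoc, ← ampl_comp,
      vacProj_comp_of_ge hst', h2, h1]
  exact congrArg (fun T => (inner ℂ _ (T ζ) : ℂ)) h3

/-! ### Integrands with vanishing right column -/

variable {A : VonNeumannAlgebra 𝔥} {G : ℝ≥0 → HatInitFock 𝔥 𝔨 →L[ℂ] HatInitFock 𝔥 𝔨}

/-- ĉ differs from the vector (1, 0) by an element of k, which T annihilates. Thus g disappears from
the defining formula of the integral and only the left column remains. -/
theorem comp_hat_of_comp_Delta {T : HatInitFock 𝔥 𝔨 →L[ℂ] HatInitFock 𝔥 𝔨}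
    (hT : T ∘L Delta 𝔥 𝔨 = 0) (c : 𝔨) (ξ : InitFock 𝔥 𝔨) :
    T (tmul (hat c) ξ) = (T ∘L inclTime) ξ := by
  have h1 : Delta 𝔥 𝔨 (tmul (hatIncl 𝔨 c) ξ) = tmul (hatIncl 𝔨 c) ξ := by
    rw [Delta, opTensor_tmul]
    simp [hatIncl]
  have h2 : T (tmul (hatIncl 𝔨 c) ξ) = 0 := by
    rw [← h1, ← ContinuousLinearMap.comp_apply, hT]
    rfl
  rw [hat_eq, tmul_add_left, map_add, h2, add_zero]
  rfl

/-- The identity is the sum of Δ and the projection onto the time component. -/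
theorem eq_comp_inclTime_of_comp_Delta {T : HatInitFock 𝔥 𝔨 →L[ℂ] HatInitFock 𝔥 𝔨}
    (hT : T ∘L Delta 𝔥 𝔨 = 0) : T = (T ∘L inclTime) ∘L (inclTime).adjoint := by
  have h : ContinuousLinearMap.id ℂ (HatInitFock 𝔥 𝔨) =
      inclTime ∘L (inclTime).adjoint + Delta 𝔥 𝔨 := by
    refine ext_tmul fun x ξ => ?_
    have h1 : (inclTime).adjoint (tmul x ξ) = (inner ℂ (hat 0) x : ℂ) • ξ :=
      ket_adjoint_tmul _ _ _
    rw [add_apply, ContinuousLinearMap.comp_apply, h1, map_smul, inclTime_apply, Delta,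
      opTensor_tmul, ← tmulL_apply, ← tmulL_apply, ← tmulL_apply, ← smul_apply, ← map_smul,
      ContinuousLinearMap.id_apply, ContinuousLinearMap.id_apply, ← add_apply, ← map_add]
    congr 2
    apply WithLp.ofLp_injective
    ext <;> simp [hat, hatIncl]
  conv_lhs => rw [← ContinuousLinearMap.comp_id T, h, ContinuousLinearMap.comp_add, hT, add_zero,
    ← ContinuousLinearMap.comp_assoc]

theorem IsIntegrand.column_adapted (hG : IsIntegrand A G) (s : ℝ≥0) :
    ampl (vacProj 𝔥 𝔨 s) ∘L (G s ∘L inclTime) = G s ∘L inclTime := by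
  rw [hG.adapted s]
  rw [← ContinuousLinearMap.comp_assoc, ← ContinuousLinearMap.comp_assoc, ← ampl_comp,
    vacProj_comp_of_le le_rfl]

theorem IsIntegrand.column_adapted_right (hG : IsIntegrand A G) (s : ℝ≥0) :
    (G s ∘L inclTime) ∘L vacProj 𝔥 𝔨 s = G s ∘L inclTime := by
  rw [ContinuousLinearMap.comp_assoc, ← ampl_comp_inclTime]
  conv_lhs => rw [hG.adapted s]
  conv_rhs => rw [hG.adapted s]
  simp only [ContinuousLinearMap.comp_assoc]
  rw [← ContinuousLinearMap.comp_assoc (ampl _) (ampl _), ← ampl_comp,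
    vacProj_comp_of_le le_rfl]

variable [TopologicalSpace.SeparableSpace 𝔥] [TopologicalSpace.SeparableSpace 𝔨]

/-! ### The quantum stochastic integral of a left column and its norm continuity -/

theorem IsIntegrand.weakMeas (hG : IsIntegrand A G) : WeakMeas G := fun y x =>
  hG.process.measurable y x

theorem IsIntegrand.colIntegrable (hG : IsIntegrand A G) (t : ℝ≥0) :
    ColIntegrable (Set.Iio t) (fun s => G s ∘L inclTime) := by
  have hm : WeakMeas fun s => G s ∘L inclTime := hG.weakMeas.comp_const_right _
  have hf := hG.finite t
  simp only [ENNReal.add_lt_top] at hf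
  exact ⟨hm, hG.column_adapted, ⟨(hm.comp_const_left _).norm.aestronglyMeasurable, hf.1.1.1⟩,
    ⟨(hm.comp_const_left _).norm.aestronglyMeasurable, hf.1.1.2⟩⟩

theorem IsQSIntegral.isColIntExp {Y : ℝ≥0 → InitFock 𝔥 𝔨 →L[ℂ] InitFock 𝔥 𝔨}
    (hY : IsQSIntegral A G Y) (hΔ : ∀ t, G t ∘L Delta 𝔥 𝔨 = 0) (t : ℝ≥0) :
    IsColIntExp (Set.Iio t) (fun s => G s ∘L inclTime) (Y t) := fun u v f g => by
  rw [hY.inner_eq]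
  simp only [ContinuousLinearMap.adjoint_inner_right, ket_apply, comp_hat_of_comp_Delta (hΔ _)]

theorem ColIntegrable.integrableOn_norm (hR : ColIntegrable S R) :
    IntegrableOn (fun s => ‖colK R s‖) S leb := memLp_one_iff_integrable.1 hR.memK

theorem ColIntegrable.integrableOn_sq (hR : ColIntegrable S R) :
    IntegrableOn (fun s => ‖colL R s‖ ^ 2) S leb := hR.memL.integrable_sq

theorem ColIntegrable.norm_le_integral (hR : ColIntegrable S R) (hS : MeasurableSet S)
    (h : IsColIntExp S R Y) :
    ‖Y‖ ≤ ∫ s in S, ‖colK R s‖ ∂leb + √(∫ s in S, ‖colL R s‖ ^ 2 ∂leb) := by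
  have := hR.norm_le hS h
  rwa [toReal_eLpNorm_one hR.memK fun _ => norm_nonneg _, toReal_eLpNorm_two hR.memL] at this

/-- Y_t − Y_r is the integral over [r, t), so its norm is controlled by the increments of the
continuous primitives of ‖k‖ and ‖l‖². -/
theorem continuous_of_isColIntExp {Y : ℝ≥0 → InitFock 𝔥 𝔨 →L[ℂ] InitFock 𝔥 𝔨}
    (hR : ∀ t, ColIntegrable (Set.Iio t) R) (hY : ∀ t, IsColIntExp (Set.Iio t) R (Y t)) :
    Continuous Y := by
  set a : ℝ≥0 → ℝ := fun t => ∫ s in Set.Iio t, ‖colK R s‖ ∂leb with ha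
  set b : ℝ≥0 → ℝ := fun t => ∫ s in Set.Iio t, ‖colL R s‖ ^ 2 ∂leb with hb
  have hac : Continuous a :=
    continuous_setIntegral_Iio_of_locally fun t => (hR t).integrableOn_norm
  have hbc : Continuous b :=
    continuous_setIntegral_Iio_of_locally fun t => (hR t).integrableOn_sq
  have key : ∀ r t, r ≤ t → ‖Y t - Y r‖ ≤ |a t - a r| + √|b t - b r| := by
    intro r t hrt
    have hsub : Set.Iio r ⊆ Set.Iio t := Set.Iio_subset_Iio hrt
    have h1 := ((hR t).mono Set.sdiff_subset).norm_le_integral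
      (measurableSet_Iio.diff measurableSet_Iio)
      ((hY t).sdiff (hY r) (hR t) measurableSet_Iio hsub)
    rw [setIntegral_sdiff measurableSet_Iio (hR t).integrableOn_norm hsub,
      setIntegral_sdiff measurableSet_Iio (hR t).integrableOn_sq hsub] at h1
    exact h1.trans (add_le_add (le_abs_self _) (Real.sqrt_le_sqrt (le_abs_self _)))
  have key' : ∀ r t, ‖Y t - Y r‖ ≤ |a t - a r| + √|b t - b r| := by
    intro r t
    rcases le_total r t with h | h
    · exact key r t h
    · rw [norm_sub_rev, abs_sub_comm, abs_sub_comm (b t)]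
      exact key t r h
  refine continuous_iff_continuousAt.2 fun r => tendsto_iff_norm_sub_tendsto_zero.2 ?_
  refine squeeze_zero (fun _ => norm_nonneg _) (fun t => key' r t) ?_
  have : Continuous fun t => |a t - a r| + √|b t - b r| := by fun_prop
  simpa using this.tendsto r

/-- Existence of the quantum stochastic integral. -/
theorem IsIntegrand.exists_isQSIntegral (hG : IsIntegrand A G)
    (hΔ : ∀ t, G t ∘L Delta 𝔥 𝔨 = 0) : ∃ Y, IsQSIntegral A G Y := by
  choose Y hY _ using fun t => (hG.colIntegrable t).exists_isColInt measurableSet_Iio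
  -- The operators are chosen separately for each t; norm continuity supplies the weak measurability
  -- in t.
  have hc := continuous_of_isColIntExp hG.colIntegrable fun t => (hY t).toExp
  refine ⟨Y, hG, ⟨⟨fun t => (hY t).mem hG.process.mem, fun ζ' ζ => ?_⟩, fun t =>
    (hY t).adapted hG.column_adapted hG.column_adapted_right⟩, fun t u v f g => ?_⟩
  · have : Continuous fun t => (inner ℂ ζ' (Y t ζ) : ℂ) := by fun_prop
    exact this.measurable
  · rw [hY]
    simp only [ContinuousLinearMap.adjoint_inner_right, ket_apply, comp_hat_of_comp_Delta (hΔ _)]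

theorem IsQSIntegral.continuous {Y : ℝ≥0 → InitFock 𝔥 𝔨 →L[ℂ] InitFock 𝔥 𝔨}
    (hY : IsQSIntegral A G Y) (hΔ : ∀ t, G t ∘L Delta 𝔥 𝔨 = 0) : Continuous Y :=
  continuous_of_isColIntExp hY.integrand.colIntegrable (hY.isColIntExp hΔ)

/-- Local boundedness on closed intervals. -/
def LocBdd {B : Type*} [Norm B] (f : ℝ≥0 → B) : Prop := ∀ t : ℝ≥0, ∃ C : ℝ, ∀ s ≤ t, ‖f s‖ ≤ C

theorem LocBdd.of_continuous {B : Type*} [NormedAddCommGroup B] {f : ℝ≥0 → B}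
    (hf : Continuous f) : LocBdd f := fun t => by
  obtain ⟨C, hC⟩ := (isCompact_Icc (a := (0 : ℝ≥0)) (b := t)).exists_bound_of_continuousOn
    hf.continuousOn
  exact ⟨C, fun s hs => hC s ⟨zero_le, hs⟩⟩

theorem LocBdd.add {B : Type*} [NormedAddCommGroup B] {f g : ℝ≥0 → B} (hf : LocBdd f)
    (hg : LocBdd g) : LocBdd fun s => f s + g s := fun t => by
  obtain ⟨C, hC⟩ := hf t
  obtain ⟨D, hD⟩ := hg t
  exact ⟨C + D, fun s hs => (norm_add_le _ _).trans (add_le_add (hC s hs) (hD s hs))⟩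

theorem IsVacAdapted.add {X Y : ℝ≥0 → InitFock 𝔥 𝔨 →L[ℂ] InitFock 𝔥 𝔨}
    (hX : IsVacAdapted A X) (hY : IsVacAdapted A Y) : IsVacAdapted A fun t => X t + Y t := by
  refine ⟨⟨fun t => add_mem (hX.process.mem t) (hY.process.mem t), fun ζ' ζ => ?_⟩, fun t => ?_⟩
  · simp only [add_apply, inner_add_right]
    exact (hX.process.measurable ζ' ζ).add (hY.process.measurable ζ' ζ)
  · conv_lhs => rw [hX.adapted t, hY.adapted t]
    rw [ContinuousLinearMap.add_comp, ContinuousLinearMap.comp_add]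

end Column

/-! ### A Gronwall inequality -/

section Gronwall

/-- This is the complex identity over the whole half-line for 1_{[0,t)} φ. -/
theorem setIntegral_mul_exp {φ : ℝ≥0 → ℝ} (hφ : Integrable φ leb) (t : ℝ≥0) :
    ∫ s in Set.Iio t, φ s * Real.exp (∫ r in Set.Iio s, φ r ∂leb) ∂leb =
      Real.exp (∫ r in Set.Iio t, φ r ∂leb) - 1 := by
  have h1 := integral_mul_exp ((hφ.indicator (measurableSet_Iio (a := t))).ofReal (𝕜 := ℂ))
  rw [← integral_indicator measurableSet_Iio, ← integral_indicator measurableSet_Iio]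
  apply Complex.ofReal_injective
  rw [← integral_complex_ofReal, Complex.ofReal_sub, Complex.ofReal_exp, Complex.ofReal_one,
    ← integral_complex_ofReal]
  refine Eq.trans (integral_congr_ae (Filter.Eventually.of_forall fun s => ?_)) h1
  by_cases hs : s < t
  · have h2 : ∫ r in Set.Iio s, φ r ∂leb = ∫ r in Set.Iio s, (Set.Iio t).indicator φ r ∂leb :=
      setIntegral_congr_fun measurableSet_Iio fun r hr => by
        rw [Set.indicator_of_mem (Set.mem_Iio.2 (lt_trans hr hs))]
    simp only [Set.indicator_of_mem (Set.mem_Iio.2 hs), h2]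
    rw [Complex.ofReal_mul, Complex.ofReal_exp, ← integral_complex_ofReal]
    rfl
  · simp [hs]

theorem integrable_mul_exp_real {φ : ℝ≥0 → ℝ} (hφ : Integrable φ leb) (h0 : ∀ s, 0 ≤ φ s) (c : ℝ)
    (hc : 0 ≤ c) : Integrable (fun s => φ s * Real.exp (c * ∫ r in Set.Iio s, φ r ∂leb)) leb := by
  refine (hφ.mul_const (Real.exp (c * ∫ r, φ r ∂leb))).mono' ?_
    (Filter.Eventually.of_forall fun s => ?_)
  · exact hφ.aestronglyMeasurable.mul
      (Real.continuous_exp.comp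
        (continuous_const.mul (continuous_setIntegral_Iio hφ))).aestronglyMeasurable
  · rw [Real.norm_of_nonneg (mul_nonneg (h0 s) (Real.exp_pos _).le)]
    gcongr
    · exact h0 s
    · exact Filter.Eventually.of_forall h0
    · exact Measure.restrict_le_self

/-- Gronwall's inequality for essentially bounded functions and integrable weights. -/
theorem ae_le_mul_exp_of_le_integral {φ h : ℝ≥0 → ℝ} (hφ : Integrable φ leb) (h0 : ∀ s, 0 ≤ φ s)
    {T : ℝ≥0} {a M : ℝ} (ha : 0 ≤ a) (hh0 : ∀ s, 0 ≤ h s)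
    (hM : ∀ s < T, h s ≤ M)
    (hle : ∀ᵐ s ∂leb.restrict (Set.Iio T), h s ≤ a + ∫ r in Set.Iio s, φ r * h r ∂leb) :
    ∀ᵐ s ∂leb.restrict (Set.Iio T), h s ≤ a * Real.exp (∫ r in Set.Iio s, φ r ∂leb) := by
  rcases eq_or_ne T 0 with rfl | hT
  · simp
  have hM0 : 0 ≤ M := (hh0 0).trans (hM 0 (pos_iff_ne_zero.2 hT))
  set Φ : ℝ≥0 → ℝ := fun s => ∫ r in Set.Iio s, φ r ∂leb with hΦ
  have hΦ0 : ∀ s, 0 ≤ Φ s := fun s => integral_nonneg h0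
  have e1 : ∀ t, ∫ s in Set.Iio t, φ s * Real.exp (Φ s) ∂leb = Real.exp (Φ t) - 1 :=
    setIntegral_mul_exp hφ
  have e2 : ∀ t, ∫ s in Set.Iio t, φ s * Real.exp (2 * Φ s) ∂leb =
      (Real.exp (2 * Φ t) - 1) / 2 := by
    intro t
    have := setIntegral_mul_exp (hφ.const_mul 2) t
    simp only [integral_const_mul, mul_assoc] at this
    linarith
  have i1 : Integrable (fun s => φ s * Real.exp (Φ s)) leb := by
    simpa using integrable_mul_exp_real hφ h0 1 zero_le_one
  have i2 : Integrable (fun s => φ s * Real.exp (2 * Φ s)) leb :=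
    integrable_mul_exp_real hφ h0 2 zero_le_two
  -- Substituting the bound into the integral inequality reproduces a exp(Φ) exactly and halves the
  -- error term, because ∫ φ exp(2Φ) = (exp(2Φ) − 1)/2. The extra 2 in the exponent is what makes
  -- the iteration contract.
  have step : ∀ n : ℕ, ∀ᵐ s ∂leb.restrict (Set.Iio T),
      h s ≤ a * Real.exp (Φ s) + M * (1 / 2) ^ n * Real.exp (2 * Φ s) := by
    intro n
    induction n with
    | zero =>
      filter_upwards [ae_restrict_mem measurableSet_Iio] with s hs
      have h1 : 1 ≤ Real.exp (2 * Φ s) := Real.one_le_exp (by linarith [hΦ0 s])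
      have h2 : 0 ≤ a * Real.exp (Φ s) := by positivity
      have h3 := hM s hs
      simp only [pow_zero, mul_one]
      nlinarith
    | succ n ih =>
      filter_upwards [ae_restrict_mem measurableSet_Iio, hle] with t ht hlt
      refine hlt.trans ?_
      have hbound : ∫ r in Set.Iio t, φ r * h r ∂leb ≤ ∫ r in Set.Iio t,
          (a * (φ r * Real.exp (Φ r)) + M * (1 / 2) ^ n * (φ r * Real.exp (2 * Φ r))) ∂leb := by
        refine integral_mono_of_nonneg
          (Filter.Eventually.of_forall fun r => mul_nonneg (h0 r) (hh0 r))
          ((i1.const_mul a).add (i2.const_mul _)).integrableOn ?_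
        have hsub : Set.Iio t ⊆ Set.Iio T := Set.Iio_subset_Iio (le_of_lt ht)
        filter_upwards [ae_restrict_of_ae_restrict_of_subset hsub ih] with r hr
        have := mul_le_mul_of_nonneg_left hr (h0 r)
        linarith
      rw [integral_add (i1.const_mul a).integrableOn (i2.const_mul _).integrableOn,
        integral_const_mul, integral_const_mul, e1, e2] at hbound
      have h2 : 0 ≤ M * (1 / 2) ^ n := by positivity
      rw [pow_succ]
      linarith
  filter_upwards [ae_all_iff.2 step] with s hs
  have hlim : Filter.Tendsto (fun n : ℕ => a * Real.exp (Φ s) + M * (1 / 2) ^ n *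
      Real.exp (2 * Φ s)) Filter.atTop (nhds (a * Real.exp (Φ s))) := by
    have := tendsto_pow_atTop_nhds_zero_of_lt_one (r := (1 / 2 : ℝ)) (by norm_num) (by norm_num)
    have := ((this.const_mul M).mul_const (Real.exp (2 * Φ s))).const_add (a * Real.exp (Φ s))
    simpa using this
  exact ge_of_tendsto' hlim hs

/-- Cauchy–Schwarz for the measure k dμ: the quadratic x ↦ ∫ k (z − x)² is nonnegative, so its
discriminant is at most zero. -/
theorem sq_integral_mul_le {α : Type*} [MeasurableSpace α] {μ : Measure α} {k z : α → ℝ}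
    (hk0 : ∀ s, 0 ≤ k s) (hk : Integrable k μ) (h1 : Integrable (fun s => k s * z s) μ)
    (h2 : Integrable (fun s => k s * z s ^ 2) μ) :
    (∫ s, k s * z s ∂μ) ^ 2 ≤ (∫ s, k s ∂μ) * ∫ s, k s * z s ^ 2 ∂μ := by
  have h : ∀ x : ℝ, 0 ≤ (∫ s, k s ∂μ) * (x * x) + (-2 * ∫ s, k s * z s ∂μ) * x +
      ∫ s, k s * z s ^ 2 ∂μ := by
    intro x
    have e : ∫ s, k s * (z s - x) ^ 2 ∂μ = (∫ s, k s ∂μ) * (x * x) +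
        (-2 * ∫ s, k s * z s ∂μ) * x + ∫ s, k s * z s ^ 2 ∂μ := by
      have : (fun s => k s * (z s - x) ^ 2) =
          fun s => (k s * (x * x) + (k s * z s) * (-2 * x)) + k s * z s ^ 2 := by
        ext s; ring
      have hadd : Integrable (fun s => k s * (x * x) + (k s * z s) * (-2 * x)) μ :=
        (hk.mul_const _).add (h1.mul_const _)
      rw [this, integral_add hadd h2, integral_add (hk.mul_const _) (h1.mul_const _), integral_mul_const, integral_mul_const]
      ring
    rw [← e]
    exact integral_nonneg fun s => mul_nonneg (hk0 s) (sq_nonneg _)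
  have := discrim_le_zero h
  rw [discrim] at this
  nlinarith

end Gronwall

/-! ### Composition of integrands with processes -/

section Compose

variable {𝔥 𝔨 : Type*}
  [NormedAddCommGroup 𝔥] [InnerProductSpace ℂ 𝔥]
  [NormedAddCommGroup 𝔨] [InnerProductSpace ℂ 𝔨]

theorem Delta_comp_ampl (T : InitFock 𝔥 𝔨 →L[ℂ] InitFock 𝔥 𝔨) :
    Delta 𝔥 𝔨 ∘L ampl T = ampl T ∘L Delta 𝔥 𝔨 := by
  rw [Delta, ampl, opTensor_comp, opTensor_comp, ContinuousLinearMap.id_comp,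
    ContinuousLinearMap.comp_id, ContinuousLinearMap.id_comp, ContinuousLinearMap.comp_id]

theorem Delta_comp_inclNoise : Delta 𝔥 𝔨 ∘L inclNoise = inclNoise := by
  rw [Delta, inclNoise, opTensor_comp, ContinuousLinearMap.id_comp]
  congr 1

theorem comp_ampl_comp_Delta {T : HatInitFock 𝔥 𝔨 →L[ℂ] HatInitFock 𝔥 𝔨}
    (hT : T ∘L Delta 𝔥 𝔨 = 0) (Z : InitFock 𝔥 𝔨 →L[ℂ] InitFock 𝔥 𝔨) :
    (T ∘L ampl Z) ∘L Delta 𝔥 𝔨 = 0 := by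
  rw [ContinuousLinearMap.comp_assoc, ← Delta_comp_ampl, ← ContinuousLinearMap.comp_assoc, hT,
    ContinuousLinearMap.zero_comp]

variable [CompleteSpace 𝔥] [CompleteSpace 𝔨]

theorem blockK_comp_ampl (T : HatInitFock 𝔥 𝔨 →L[ℂ] HatInitFock 𝔥 𝔨)
    (Z : InitFock 𝔥 𝔨 →L[ℂ] InitFock 𝔥 𝔨) : blockK (T ∘L ampl Z) = blockK T ∘L Z := by
  simp only [blockK, ContinuousLinearMap.comp_assoc, ampl_comp_inclTime]

theorem blockL_comp_ampl (T : HatInitFock 𝔥 𝔨 →L[ℂ] HatInitFock 𝔥 𝔨)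
    (Z : InitFock 𝔥 𝔨 →L[ℂ] InitFock 𝔥 𝔨) : blockL (T ∘L ampl Z) = blockL T ∘L Z := by
  simp only [blockL, ContinuousLinearMap.comp_assoc, ampl_comp_inclTime]

theorem comp_inclNoise_of_comp_Delta {T : HatInitFock 𝔥 𝔨 →L[ℂ] HatInitFock 𝔥 𝔨}
    (hT : T ∘L Delta 𝔥 𝔨 = 0) : T ∘L inclNoise = 0 := by
  rw [← Delta_comp_inclNoise, ← ContinuousLinearMap.comp_assoc, hT, ContinuousLinearMap.zero_comp]

theorem locNorm_comp_le {E F K : Type*} [NormedAddCommGroup E] [NormedSpace ℂ E]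
    [NormedAddCommGroup F] [NormedSpace ℂ F] [NormedAddCommGroup K] [NormedSpace ℂ K]
    {p : ℝ≥0∞} {t : ℝ≥0} {k : ℝ≥0 → F →L[ℂ] K} {Z : ℝ≥0 → E →L[ℂ] F} {C : ℝ}
    (hC : ∀ s ≤ t, ‖Z s‖ ≤ C) :
    locNorm p t (fun s => k s ∘L Z s) ≤ ENNReal.ofReal C * locNorm p t k := by
  refine eLpNorm_le_mul_eLpNorm_of_ae_le_mul ?_ p
  filter_upwards [ae_restrict_mem measurableSet_Iio] with s hs
  rw [norm_norm, norm_norm, mul_comm]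
  exact ((k s).opNorm_comp_le (Z s)).trans
    (mul_le_mul_of_nonneg_left (hC s (le_of_lt hs)) (norm_nonneg _))

variable [TopologicalSpace.SeparableSpace 𝔥] [TopologicalSpace.SeparableSpace 𝔨]
variable {A : VonNeumannAlgebra 𝔥} {G : ℝ≥0 → HatInitFock 𝔥 𝔨 →L[ℂ] HatInitFock 𝔥 𝔨}
  {Z Z' Y Y' : ℝ≥0 → InitFock 𝔥 𝔨 →L[ℂ] InitFock 𝔥 𝔨}

theorem IsVacAdapted.weakMeas (hZ : IsVacAdapted A Z) : WeakMeas Z := hZ.process.measurable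

/-- The blocks become kZ, lZ, 0, 0, and local boundedness of Z preserves the integrability of the
first two. Weak measurability is reduced to a composition through the separable space h ⊗ F. -/
theorem IsIntegrand.comp_ampl (hG : IsIntegrand A G) (hΔ : ∀ t, G t ∘L Delta 𝔥 𝔨 = 0)
    (hZ : IsVacAdapted A Z) (hb : LocBdd Z) : IsIntegrand A fun s => G s ∘L ampl (Z s) := by
  refine ⟨⟨fun s => mul_mem (hG.process.mem s) (ampl_mem_tensorVN (hZ.process.mem s)), ?_⟩,
    fun s => ?_, fun t => ?_⟩
  · have h1 : (fun s => G s ∘L ampl (Z s)) =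
        fun s => ((G s ∘L inclTime) ∘L Z s) ∘L (inclTime).adjoint := by
      ext1 s
      conv_lhs => rw [eq_comp_inclTime_of_comp_Delta (comp_ampl_comp_Delta (hΔ s) (Z s))]
      rw [ContinuousLinearMap.comp_assoc (G s), ampl_comp_inclTime,
        ← ContinuousLinearMap.comp_assoc (G s)]
    have h2 : WeakMeas fun s => G s ∘L ampl (Z s) := by
      rw [h1]
      exact (((hG.weakMeas.comp_const_right _).comp hZ.weakMeas).comp_const_right _)
    exact h2
  · have h1 : ampl (vacProj 𝔥 𝔨 s) ∘L G s = G s := by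
      conv_lhs => rw [hG.adapted s]
      conv_rhs => rw [hG.adapted s]
      rw [← ContinuousLinearMap.comp_assoc, ← ampl_comp, vacProj_comp_of_le le_rfl]
    have h2 : Z s ∘L vacProj 𝔥 𝔨 s = Z s := by
      conv_lhs => rw [hZ.adapted s]
      conv_rhs => rw [hZ.adapted s]
      rw [ContinuousLinearMap.comp_assoc, ContinuousLinearMap.comp_assoc,
        vacProj_comp_of_le le_rfl]
    rw [ContinuousLinearMap.comp_assoc, ← ampl_comp, h2, ← ContinuousLinearMap.comp_assoc, h1]
  · obtain ⟨C, hC⟩ := hb t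
    have hf := hG.finite t
    have hz : ∀ s, (G s ∘L ampl (Z s)) ∘L inclNoise = 0 := fun s =>
      comp_inclNoise_of_comp_Delta (comp_ampl_comp_Delta (hΔ s) (Z s))
    simp only [ENNReal.add_lt_top] at hf ⊢
    refine ⟨⟨⟨?_, ?_⟩, ?_⟩, ?_⟩
    · simp only [blockK_comp_ampl]
      exact (locNorm_comp_le hC).trans_lt (ENNReal.mul_lt_top ENNReal.ofReal_lt_top hf.1.1.1)
    · simp only [blockL_comp_ampl]
      exact (locNorm_comp_le hC).trans_lt (ENNReal.mul_lt_top ENNReal.ofReal_lt_top hf.1.1.2)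
    · simp [blockM, hz, locNorm]
    · simp only [blockN, hz, ContinuousLinearMap.comp_zero, locNorm, norm_zero]
      rw [eLpNorm_zero']
      exact ENNReal.zero_lt_top

/-! ### The quadratic estimate for differences of integrals -/

/-- The weight `4 (‖l‖² + ‖k‖_{1,T} ‖k‖)` on `[0, T)`. -/
def weight (G : ℝ≥0 → HatInitFock 𝔥 𝔨 →L[ℂ] HatInitFock 𝔥 𝔨) (T : ℝ≥0) : ℝ≥0 → ℝ :=
  (Set.Iio T).indicator fun s => 4 * (‖blockL (G s)‖ ^ 2 +
    (∫ r in Set.Iio T, ‖blockK (G r)‖ ∂leb) * ‖blockK (G s)‖)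

theorem weight_nonneg (T s : ℝ≥0) : 0 ≤ weight G T s :=
  Set.indicator_nonneg (fun s _ => by positivity) s

theorem IsIntegrand.integrableOn_blockK (hG : IsIntegrand A G) (T : ℝ≥0) :
    IntegrableOn (fun s => ‖blockK (G s)‖) (Set.Iio T) leb :=
  (hG.colIntegrable T).integrableOn_norm

theorem IsIntegrand.integrableOn_blockL (hG : IsIntegrand A G) (T : ℝ≥0) :
    IntegrableOn (fun s => ‖blockL (G s)‖ ^ 2) (Set.Iio T) leb :=
  (hG.colIntegrable T).integrableOn_sq

theorem IsIntegrand.integrable_weight (hG : IsIntegrand A G) (T : ℝ≥0) :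
    Integrable (weight G T) leb := by
  rw [weight, integrable_indicator_iff measurableSet_Iio]
  exact ((hG.integrableOn_blockL T).add ((hG.integrableOn_blockK T).const_mul _)).const_mul 4

/-- This is twice the exponent of the final estimate, because Gronwall's inequality is applied to
‖Z‖². -/
theorem IsIntegrand.integral_weight (hG : IsIntegrand A G) (T : ℝ≥0) :
    ∫ s in Set.Iio T, weight G T s ∂leb =
      4 * (locNorm 2 T fun s => blockL (G s)).toReal ^ 2 +
      4 * (locNorm 1 T fun s => blockK (G s)).toReal ^ 2 := by
  have h1 : (locNorm 1 T fun s => blockK (G s)).toReal = ∫ s in Set.Iio T, ‖blockK (G s)‖ ∂leb :=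
    toReal_eLpNorm_one (hG.colIntegrable T).memK fun _ => norm_nonneg _
  have h2 : (locNorm 2 T fun s => blockL (G s)).toReal =
      √(∫ s in Set.Iio T, ‖blockL (G s)‖ ^ 2 ∂leb) :=
    toReal_eLpNorm_two (hG.colIntegrable T).memL
  rw [h1, h2, Real.sq_sqrt (integral_nonneg fun _ => sq_nonneg _), weight,
    setIntegral_indicator measurableSet_Iio, Set.inter_self, integral_const_mul,
    integral_add (hG.integrableOn_blockL T) ((hG.integrableOn_blockK T).const_mul _),
    integral_const_mul]
  ring

theorem integrableOn_mul_of_bdd {k z : ℝ≥0 → ℝ} {t : ℝ≥0} {C : ℝ}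
    (hk : IntegrableOn k (Set.Iio t) leb) (hz : Measurable z)
    (hC : ∀ s ≤ t, ‖z s‖ ≤ C) : IntegrableOn (fun s => k s * z s) (Set.Iio t) leb := by
  refine (hk.norm.mul_const C).mono' (hk.aestronglyMeasurable.mul hz.aestronglyMeasurable) ?_
  filter_upwards [ae_restrict_mem measurableSet_Iio] with s hs
  rw [norm_mul]
  exact mul_le_mul_of_nonneg_left (hC s (le_of_lt hs)) (norm_nonneg _)

/-- The basic quadratic estimate for differences of integrals. -/
theorem IsQSIntegral.norm_sub_sq_le (hG : IsIntegrand A G) (hΔ : ∀ t, G t ∘L Delta 𝔥 𝔨 = 0)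
    (hZ : IsVacAdapted A Z) (hb : LocBdd Z) (hZ' : IsVacAdapted A Z') (hb' : LocBdd Z')
    (hY : IsQSIntegral A (fun s => G s ∘L ampl (Z s)) Y)
    (hY' : IsQSIntegral A (fun s => G s ∘L ampl (Z' s)) Y') {t T : ℝ≥0} (htT : t ≤ T) :
    ‖Y t - Y' t‖ ^ 2 ≤
      (1 / 2) * ∫ s in Set.Iio t, weight G T s * ‖Z s - Z' s‖ ^ 2 ∂leb := by
  set z : ℝ≥0 → ℝ := fun s => ‖Z s - Z' s‖ with hzdef
  have hzm : Measurable z := (hZ.weakMeas.sub hZ'.weakMeas).norm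
  obtain ⟨C, hC⟩ : ∃ C, ∀ s ≤ t, z s ≤ C := by
    obtain ⟨C, hC⟩ := hb t
    obtain ⟨D, hD⟩ := hb' t
    exact ⟨C + D, fun s hs => (norm_sub_le _ _).trans (add_le_add (hC s hs) (hD s hs))⟩
  have hz0 : ∀ s, 0 ≤ z s := fun s => norm_nonneg _
  have hC1 : ∀ s ≤ t, ‖z s‖ ≤ C := fun s hs => by
    rw [Real.norm_of_nonneg (hz0 s)]; exact hC s hs
  have hC2 : ∀ s ≤ t, ‖z s ^ 2‖ ≤ C ^ 2 := fun s hs => by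
    rw [norm_pow]; exact pow_le_pow_left₀ (norm_nonneg _) (hC1 s hs) 2
  set k : ℝ≥0 → ℝ := fun s => ‖blockK (G s)‖ with hk
  set l : ℝ≥0 → ℝ := fun s => ‖blockL (G s)‖ with hl
  have ik := hG.integrableOn_blockK t
  have il := hG.integrableOn_blockL t
  have ikz := integrableOn_mul_of_bdd ik hzm hC1
  have ikz2 := integrableOn_mul_of_bdd ik (hzm.pow_const 2) hC2
  have ilz2 := integrableOn_mul_of_bdd il (hzm.pow_const 2) hC2
  have hΔ1 : ∀ s, (G s ∘L ampl (Z s)) ∘L Delta 𝔥 𝔨 = 0 := fun s => comp_ampl_comp_Delta (hΔ s) _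
  have hΔ2 : ∀ s, (G s ∘L ampl (Z' s)) ∘L Delta 𝔥 𝔨 = 0 := fun s => comp_ampl_comp_Delta (hΔ s) _
  have hR := hY.integrand.colIntegrable t
  have hR' := hY'.integrand.colIntegrable t
  have hn := (hR.sub hR').norm_le_integral measurableSet_Iio
    ((hY.isColIntExp hΔ1 t).sub (hY'.isColIntExp hΔ2 t) hR hR')
  have hcol : ∀ s, (G s ∘L ampl (Z s)) ∘L inclTime - (G s ∘L ampl (Z' s)) ∘L inclTime =
      (G s ∘L inclTime) ∘L (Z s - Z' s) := fun s => by
    rw [ContinuousLinearMap.comp_assoc, ContinuousLinearMap.comp_assoc, ampl_comp_inclTime,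
      ampl_comp_inclTime, ContinuousLinearMap.comp_sub, ContinuousLinearMap.comp_assoc,
      ContinuousLinearMap.comp_assoc]
  have hp : ∫ s in Set.Iio t, ‖colK (fun s => (G s ∘L ampl (Z s)) ∘L inclTime -
      (G s ∘L ampl (Z' s)) ∘L inclTime) s‖ ∂leb ≤ ∫ s in Set.Iio t, k s * z s ∂leb := by
    refine integral_mono_of_nonneg (Filter.Eventually.of_forall fun s => norm_nonneg _) ikz
      (Filter.Eventually.of_forall fun s => ?_)
    simp only [hcol]
    exact (blockK (G s)).opNorm_comp_le (Z s - Z' s)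
  have hq : ∫ s in Set.Iio t, ‖colL (fun s => (G s ∘L ampl (Z s)) ∘L inclTime -
      (G s ∘L ampl (Z' s)) ∘L inclTime) s‖ ^ 2 ∂leb ≤ ∫ s in Set.Iio t, l s ^ 2 * z s ^ 2 ∂leb := by
    refine integral_mono_of_nonneg (Filter.Eventually.of_forall fun s => sq_nonneg _) ilz2
      (Filter.Eventually.of_forall fun s => ?_)
    simp only [hcol]
    rw [← mul_pow]
    exact pow_le_pow_left₀ (norm_nonneg _) ((blockL (G s)).opNorm_comp_le (Z s - Z' s)) 2
  have hcs := sq_integral_mul_le (fun s => norm_nonneg _) ik ikz ikz2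
  -- Replacing ‖k‖_{1,t} by ‖k‖_{1,T} gives one weight valid for all t ≤ T, as iteration and
  -- Gronwall require.
  have hkT : ∫ s in Set.Iio t, k s ∂leb ≤ ∫ s in Set.Iio T, k s ∂leb :=
    setIntegral_mono_set (hG.integrableOn_blockK T)
      (Filter.Eventually.of_forall fun s => norm_nonneg _)
      (Filter.Eventually.of_forall (Set.Iio_subset_Iio htT))
  have hw : ∫ s in Set.Iio t, weight G T s * z s ^ 2 ∂leb =
      4 * ((∫ s in Set.Iio t, l s ^ 2 * z s ^ 2 ∂leb) +
        (∫ s in Set.Iio T, k s ∂leb) * ∫ s in Set.Iio t, k s * z s ^ 2 ∂leb) := by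
    rw [← integral_const_mul (∫ s in Set.Iio T, k s ∂leb),
      ← integral_add ilz2 (ikz2.const_mul _), ← integral_const_mul]
    refine setIntegral_congr_fun measurableSet_Iio fun s hs => ?_
    simp only [weight]
    rw [Set.indicator_of_mem (Set.mem_Iio.2 (lt_of_lt_of_le hs htT))]
    ring
  have hkz2 : 0 ≤ ∫ s in Set.Iio t, k s * z s ^ 2 ∂leb :=
    integral_nonneg fun s => mul_nonneg (norm_nonneg _) (sq_nonneg _)
  have hlz2 : 0 ≤ ∫ s in Set.Iio t, l s ^ 2 * z s ^ 2 ∂leb :=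
    integral_nonneg fun s => by positivity
  rw [hw]
  have hfin : ‖Y t - Y' t‖ ≤ (∫ s in Set.Iio t, k s * z s ∂leb) +
      √(∫ s in Set.Iio t, l s ^ 2 * z s ^ 2 ∂leb) :=
    hn.trans (add_le_add hp (Real.sqrt_le_sqrt hq))
  have hsq := pow_le_pow_left₀ (norm_nonneg _) hfin 2
  have hs2 := Real.sq_sqrt hlz2
  have hmul := mul_le_mul_of_nonneg_right hkT hkz2
  -- With p = ∫ k z and q the square root, (p + q)² ≤ 2p² + 2q² and p² ≤ ‖k‖_1 ∫ k z². The factor 4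
  -- in the weight turns the resulting 2 into ½, the contraction factor of the Picard iteration.
  nlinarith [sq_nonneg ((∫ s in Set.Iio t, k s * z s ∂leb) -
      √(∫ s in Set.Iio t, l s ^ 2 * z s ^ 2 ∂leb))]

end Compose

/-! ### The quantum stochastic differential equation -/

section Solution

variable {𝔥 𝔨 : Type*}
  [NormedAddCommGroup 𝔥] [InnerProductSpace ℂ 𝔥]
  [NormedAddCommGroup 𝔨] [InnerProductSpace ℂ 𝔨]
  [CompleteSpace 𝔥] [CompleteSpace 𝔨]
  [TopologicalSpace.SeparableSpace 𝔥] [TopologicalSpace.SeparableSpace 𝔨]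
  {A : VonNeumannAlgebra 𝔥} {G : ℝ≥0 → HatInitFock 𝔥 𝔨 →L[ℂ] HatInitFock 𝔥 𝔨}
  {X Z Z' Y : ℝ≥0 → InitFock 𝔥 𝔨 →L[ℂ] InitFock 𝔥 𝔨}

/-! ### Uniqueness, the a priori bound and continuity -/

theorem isVacAdapted_zero : IsVacAdapted A (fun _ => (0 : InitFock 𝔥 𝔨 →L[ℂ] InitFock 𝔥 𝔨)) :=
  ⟨⟨fun _ => zero_mem _, fun _ _ => by simp⟩, fun _ => by simp⟩

theorem locBdd_zero : LocBdd (fun _ => (0 : InitFock 𝔥 𝔨 →L[ℂ] InitFock 𝔥 𝔨)) :=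
  fun _ => ⟨0, fun _ _ => by simp⟩

theorem ampl_zero : ampl (0 : InitFock 𝔥 𝔨 →L[ℂ] InitFock 𝔥 𝔨) = 0 :=
  ext_tmul fun x y => by rw [ampl_tmul]; simp [← tmulL_apply]

/-- Comparison with the zero process turns the difference estimate into a bound for a single
integral. -/
theorem isQSIntegral_zero (hG : IsIntegrand A G) (hΔ : ∀ t, G t ∘L Delta 𝔥 𝔨 = 0) :
    IsQSIntegral A (fun s => G s ∘L ampl (0 : InitFock 𝔥 𝔨 →L[ℂ] InitFock 𝔥 𝔨))
      (fun _ => 0) :=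
  ⟨hG.comp_ampl hΔ isVacAdapted_zero locBdd_zero, isVacAdapted_zero, fun t u v f g => by
    simp [ampl_zero]⟩

/-- Z is X plus a norm continuous integral, which is bounded on compact intervals. Hence uniqueness
needs no boundedness assumption on the solutions. -/
theorem IsSolution.locBdd (hX : LocBdd X) (hΔ : ∀ t, G t ∘L Delta 𝔥 𝔨 = 0)
    (hZ : IsSolution A G X Z) : LocBdd Z := by
  obtain ⟨Y, hY, hZY⟩ := hZ.eqn
  have : Z = fun s => X s + Y s := funext hZY
  rw [this]
  exact hX.add (.of_continuous (hY.continuous fun s => comp_ampl_comp_Delta (hΔ s) _))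

theorem IsQSIntegral.norm_sq_le (hG : IsIntegrand A G) (hΔ : ∀ t, G t ∘L Delta 𝔥 𝔨 = 0)
    (hZ : IsVacAdapted A Z) (hb : LocBdd Z)
    (hY : IsQSIntegral A (fun s => G s ∘L ampl (Z s)) Y) {t T : ℝ≥0} (htT : t ≤ T) :
    ‖Y t‖ ^ 2 ≤ (1 / 2) * ∫ s in Set.Iio t, weight G T s * ‖Z s‖ ^ 2 ∂leb := by
  simpa using hY.norm_sub_sq_le hG hΔ hZ hb isVacAdapted_zero locBdd_zero
    (isQSIntegral_zero hG hΔ) htT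

theorem LocBdd.exists_sq_le {B : Type*} [NormedAddCommGroup B] {f g : ℝ≥0 → B} (hf : LocBdd f)
    (hg : LocBdd g) (t : ℝ≥0) : ∃ M : ℝ, 0 ≤ M ∧ ∀ s ≤ t, ‖f s - g s‖ ^ 2 ≤ M := by
  obtain ⟨C, hC⟩ := hf t
  obtain ⟨D, hD⟩ := hg t
  exact ⟨(C + D) ^ 2, sq_nonneg _, fun s hs => pow_le_pow_left₀ (norm_nonneg _)
    ((norm_sub_le _ _).trans (add_le_add (hC s hs) (hD s hs))) 2⟩

/-- The difference of two solutions is a difference of integrals, so its squared norm satisfies the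
Gronwall inequality with initial constant 0. -/
theorem IsSolution.unique (hG : IsIntegrand A G) (hΔ : ∀ t, G t ∘L Delta 𝔥 𝔨 = 0)
    (hX : LocBdd X) (hZ : IsSolution A G X Z) (hZ' : IsSolution A G X Z') : Z = Z' := by
  have hb := hZ.locBdd hX hΔ
  have hb' := hZ'.locBdd hX hΔ
  obtain ⟨Y, hY, hZY⟩ := hZ.eqn
  obtain ⟨Y', hY', hZY'⟩ := hZ'.eqn
  have est : ∀ t T, t ≤ T → ‖Z t - Z' t‖ ^ 2 ≤
      (1 / 2) * ∫ s in Set.Iio t, weight G T s * ‖Z s - Z' s‖ ^ 2 ∂leb := by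
    intro t T htT
    have h : Z t - Z' t = Y t - Y' t := by rw [hZY, hZY']; abel
    rw [h]
    exact hY.norm_sub_sq_le hG hΔ hZ.adapted hb hZ'.adapted hb' hY' htT
  funext t
  obtain ⟨M, -, hM⟩ := hb.exists_sq_le hb' t
  have hint0 : ∀ s, 0 ≤ ∫ r in Set.Iio s, weight G t r * ‖Z r - Z' r‖ ^ 2 ∂leb := fun s =>
    integral_nonneg fun r => mul_nonneg (weight_nonneg _ _) (sq_nonneg _)
  have hae := ae_le_mul_exp_of_le_integral (h := fun s => ‖Z s - Z' s‖ ^ 2)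
    (hG.integrable_weight t) (weight_nonneg t) (T := t) le_rfl (fun s => sq_nonneg _)
    (fun s hs => hM s (le_of_lt hs)) (by
      filter_upwards [ae_restrict_mem measurableSet_Iio] with s hs
      have := est s t (le_of_lt hs)
      linarith [hint0 s])
  -- Gronwall gives equality only almost everywhere; feeding this back into the quadratic estimate
  -- gives equality at the time t itself.
  have hzero : ∫ s in Set.Iio t, weight G t s * ‖Z s - Z' s‖ ^ 2 ∂leb = 0 := by
    refine integral_eq_zero_of_ae ?_
    filter_upwards [hae] with s hs
    rw [zero_mul] at hs
    rw [le_antisymm hs (sq_nonneg _), mul_zero, Pi.zero_apply]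
  have h := est t t le_rfl
  rw [hzero, mul_zero] at h
  have h2 : ‖Z t - Z' t‖ = 0 := pow_eq_zero_iff two_ne_zero |>.1 (le_antisymm h (sq_nonneg _))
  exact sub_eq_zero.1 (norm_eq_zero.1 h2)

theorem locNorm_top_lt_top (hX : LocBdd X) (t : ℝ≥0) : locNorm ∞ t X < ∞ := by
  obtain ⟨C, hC⟩ := hX t
  rw [locNorm, eLpNorm_exponent_top]
  refine (eLpNormEssSup_le_of_ae_bound (C := C) ?_).trans_lt ENNReal.ofReal_lt_top
  filter_upwards [ae_restrict_mem measurableSet_Iio] with s hs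
  rw [norm_norm]
  exact hC s (le_of_lt hs)

theorem ae_norm_le_locNorm_top (hX : LocBdd X) (t : ℝ≥0) :
    ∀ᵐ s ∂leb.restrict (Set.Iio t), ‖X s‖ ≤ (locNorm ∞ t X).toReal := by
  filter_upwards [ae_le_eLpNormEssSup (f := fun s => ‖X s‖) (μ := leb.restrict (Set.Iio t))]
    with s hs
  have h := ENNReal.toReal_mono (locNorm_top_lt_top hX t).ne hs
  simpa using h

/-- The a priori bound for solutions. -/
theorem IsSolution.locNorm_le (hG : IsIntegrand A G) (hΔ : ∀ t, G t ∘L Delta 𝔥 𝔨 = 0)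
    (hX : LocBdd X) (hZ : IsSolution A G X Z) (t : ℝ≥0) :
    locNorm ∞ t Z ≤ ENNReal.ofReal (Real.sqrt 2) * locNorm ∞ t X * ENNReal.ofReal (Real.exp
      (2 * (locNorm 2 t fun s => blockL (G s)).toReal ^ 2 +
        2 * (locNorm 1 t fun s => blockK (G s)).toReal ^ 2)) := by
  have hb := hZ.locBdd hX hΔ
  obtain ⟨Y, hY, hZY⟩ := hZ.eqn
  set a := (locNorm ∞ t X).toReal with ha
  have ha0 : 0 ≤ a := ENNReal.toReal_nonneg
  obtain ⟨M, -, hM⟩ := hb.exists_sq_le locBdd_zero t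
  simp only [sub_zero] at hM
  -- From ‖Z‖² ≤ 2‖X‖² + 2‖Y‖², the second 2 cancels the ½ of the quadratic estimate. The bound
  -- ‖X_s‖ ≤ a, an essential supremum, holds only almost everywhere, which is why Gronwall is used
  -- in almost-everywhere form.
  have hae := ae_le_mul_exp_of_le_integral (h := fun s => ‖Z s‖ ^ 2) (a := 2 * a ^ 2)
    (hG.integrable_weight t) (weight_nonneg t) (T := t) (by positivity) (fun s => sq_nonneg _)
    (fun s hs => hM s (le_of_lt hs)) (by
      filter_upwards [ae_restrict_mem measurableSet_Iio, ae_norm_le_locNorm_top hX t] with s hs hXs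
      have h1 := hY.norm_sq_le hG hΔ hZ.adapted hb (le_of_lt hs)
      have h2 : ‖Z s‖ ≤ ‖X s‖ + ‖Y s‖ := by rw [hZY]; exact norm_add_le _ _
      have h3 := pow_le_pow_left₀ (norm_nonneg _) h2 2
      have h4 := pow_le_pow_left₀ (norm_nonneg _) hXs 2
      nlinarith [sq_nonneg (‖X s‖ - ‖Y s‖)])
  set E := 2 * (locNorm 2 t fun s => blockL (G s)).toReal ^ 2 +
        2 * (locNorm 1 t fun s => blockK (G s)).toReal ^ 2 with hE
  have hW : ∫ s in Set.Iio t, weight G t s ∂leb = 2 * E := by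
    rw [hG.integral_weight, hE]; ring
  have hbd : ∀ᵐ s ∂leb.restrict (Set.Iio t), ‖‖Z s‖‖ ≤ √2 * a * Real.exp E := by
    filter_upwards [hae, ae_restrict_mem measurableSet_Iio] with s hs hst
    rw [norm_norm]
    -- The square of √2 a exp(E) is 2a² exp(2E), and 2E is the integral of the weight over [0, t).
    refine (sq_le_sq₀ (norm_nonneg _) (by positivity)).1 (hs.trans ?_)
    rw [mul_pow, mul_pow, Real.sq_sqrt zero_le_two, ← Real.exp_nat_mul, Nat.cast_ofNat, ← hW]
    gcongr
    · exact Filter.Eventually.of_forall (weight_nonneg t)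
    · exact (hG.integrable_weight t).integrableOn
    · exact le_of_lt hst
  rw [locNorm, eLpNorm_exponent_top]
  refine (eLpNormEssSup_le_of_ae_bound hbd).trans_eq ?_
  rw [ENNReal.ofReal_mul (by positivity), ENNReal.ofReal_mul (by positivity), ha,
    ENNReal.ofReal_toReal (locNorm_top_lt_top hX t).ne]

/-- Z and X differ by an integral, which is always norm continuous. -/
theorem IsSolution.continuous_iff (hΔ : ∀ t, G t ∘L Delta 𝔥 𝔨 = 0)
    (hZ : IsSolution A G X Z) : Continuous Z ↔ Continuous X := by
  obtain ⟨Y, hY, hZY⟩ := hZ.eqn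
  have hYc := hY.continuous fun s => comp_ampl_comp_Delta (hΔ s) _
  constructor
  · intro h
    have : X = fun t => Z t - Y t := funext fun t => by rw [hZY]; abel
    rw [this]
    exact h.sub hYc
  · intro h
    have : Z = fun t => X t + Y t := funext hZY
    rw [this]
    exact h.add hYc

/-! ### Existence by Picard iteration -/

/-- Vacuum-adapted processes are closed under pointwise limits in norm. -/
theorem isVacAdapted_of_tendsto {F : ℕ → ℝ≥0 → InitFock 𝔥 𝔨 →L[ℂ] InitFock 𝔥 𝔨}
    (hF : ∀ n, IsVacAdapted A (F n))
    (h : ∀ t, Filter.Tendsto (fun n => F n t) Filter.atTop (nhds (Z t))) : IsVacAdapted A Z := by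
  have hcont : ∀ C D : InitFock 𝔥 𝔨 →L[ℂ] InitFock 𝔥 𝔨,
      Continuous fun T : InitFock 𝔥 𝔨 →L[ℂ] InitFock 𝔥 𝔨 => C ∘L T ∘L D := fun C D =>
    continuous_const.clm_comp (continuous_id.clm_comp continuous_const)
  refine ⟨⟨fun t => mem_generatedVN.2 fun B hB => ?_, fun ζ' ζ => ?_⟩, fun t => ?_⟩
  · have h1 := ((hcont B (.id ℂ _)).tendsto _).comp (h t)
    have h2 := ((hcont (.id ℂ _) B).tendsto _).comp (h t)
    exact tendsto_nhds_unique h1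
      (h2.congr fun n => (mem_generatedVN.1 ((hF n).process.mem t) B hB).symm)
  · refine measurable_of_tendsto_metrizable (fun n => (hF n).process.measurable ζ' ζ)
      (tendsto_pi_nhds.2 fun t => ?_)
    have hc : Continuous fun T : InitFock 𝔥 𝔨 →L[ℂ] InitFock 𝔥 𝔨 => (inner ℂ ζ' (T ζ) : ℂ) := by
      fun_prop
    exact (hc.tendsto _).comp (h t)
  · have h1 := ((hcont (vacProj 𝔥 𝔨 t) (vacProj 𝔥 𝔨 t)).tendsto _).comp (h t)
    exact tendsto_nhds_unique (h t) (h1.congr fun n => ((hF n).adapted t).symm)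

/-- The Picard iteration. -/
theorem exists_picard_sequence (hG : IsIntegrand A G) (hΔ : ∀ t, G t ∘L Delta 𝔥 𝔨 = 0)
    (hX : IsVacAdapted A X) (hXb : LocBdd X) :
    ∃ F J : ℕ → ℝ≥0 → InitFock 𝔥 𝔨 →L[ℂ] InitFock 𝔥 𝔨, (∀ n, IsVacAdapted A (F n)) ∧
      (∀ n, LocBdd (F n)) ∧ (∀ n, IsQSIntegral A (fun s => G s ∘L ampl (F n s)) (J n)) ∧
      F 0 = X ∧ ∀ n s, F (n + 1) s = X s + J n s := by
  have hex : ∀ Z : {Z : ℝ≥0 → InitFock 𝔥 𝔨 →L[ℂ] InitFock 𝔥 𝔨 // IsVacAdapted A Z ∧ LocBdd Z},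
      ∃ Y, IsQSIntegral A (fun s => G s ∘L ampl (Z.1 s)) Y := fun Z =>
    (hG.comp_ampl hΔ Z.2.1 Z.2.2).exists_isQSIntegral fun s => comp_ampl_comp_Delta (hΔ s) _
  choose I hI using hex
  have hIb : ∀ Z, LocBdd (I Z) := fun Z =>
    .of_continuous ((hI Z).continuous fun s => comp_ampl_comp_Delta (hΔ s) _)
  -- The recursion runs in the subtype of locally bounded vacuum-adapted processes, since only there
  -- is the integral known to exist.
  obtain ⟨F, hF0, hFs⟩ : ∃ F : ℕ → {Z : ℝ≥0 → InitFock 𝔥 𝔨 →L[ℂ] InitFock 𝔥 𝔨 //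
      IsVacAdapted A Z ∧ LocBdd Z}, (F 0).1 = X ∧ ∀ n s, (F (n + 1)).1 s = X s + I (F n) s :=
    ⟨fun n => Nat.rec ⟨X, hX, hXb⟩
      (fun _ Z => ⟨fun s => X s + I Z s, hX.add (hI Z).adapted, hXb.add (hIb Z)⟩) n,
      rfl, fun _ _ => rfl⟩
  exact ⟨fun n => (F n).1, fun n => I (F n), fun n => (F n).2.1, fun n => (F n).2.2,
    fun n => hI _, hF0, hFs⟩

/-- Carrying the factor exp(∫_0^s w) makes the induction close: its integral against w is exp(∫_0^s
w) − 1, so each step gains the full ½ of the quadratic estimate. -/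
theorem picard_step_sq_le (hG : IsIntegrand A G) (hΔ : ∀ t, G t ∘L Delta 𝔥 𝔨 = 0)
    {F J : ℕ → ℝ≥0 → InitFock 𝔥 𝔨 →L[ℂ] InitFock 𝔥 𝔨} (hFa : ∀ n, IsVacAdapted A (F n))
    (hFb : ∀ n, LocBdd (F n)) (hJ : ∀ n, IsQSIntegral A (fun s => G s ∘L ampl (F n s)) (J n))
    (hFs : ∀ n s, F (n + 1) s = X s + J n s) (T : ℝ≥0) : ∃ M : ℝ, 0 ≤ M ∧ ∀ n, ∀ s ≤ T,
      ‖F (n + 1) s - F n s‖ ^ 2 ≤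
        M * (1 / 2) ^ n * Real.exp (∫ r in Set.Iio s, weight G T r ∂leb) := by
  obtain ⟨M, hM0, hM⟩ := (hFb 1).exists_sq_le (hFb 0) T
  have hw := hG.integrable_weight T
  refine ⟨M, hM0, fun n => ?_⟩
  induction n with
  | zero =>
    intro s hs
    rw [pow_zero, mul_one]
    exact (hM s hs).trans (le_mul_of_one_le_right hM0
      (Real.one_le_exp (integral_nonneg (weight_nonneg T))))
  | succ n ih =>
    intro s hs
    have hdiff : F (n + 1 + 1) s - F (n + 1) s = J (n + 1) s - J n s := by
      rw [hFs (n + 1), hFs n, add_sub_add_left_eq_sub]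
    rw [hdiff]
    refine ((hJ _).norm_sub_sq_le hG hΔ (hFa (n + 1)) (hFb (n + 1)) (hFa n) (hFb n)
      (hJ _) hs).trans ?_
    have hint : Integrable (fun r => weight G T r *
        Real.exp (∫ q in Set.Iio r, weight G T q ∂leb)) leb := by
      simpa using integrable_mul_exp_real hw (weight_nonneg T) 1 zero_le_one
    have hb : ∫ r in Set.Iio s, weight G T r * ‖F (n + 1) r - F n r‖ ^ 2 ∂leb ≤
        ∫ r in Set.Iio s, M * (1 / 2) ^ n * (weight G T r *
          Real.exp (∫ q in Set.Iio r, weight G T q ∂leb)) ∂leb := by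
      refine integral_mono_of_nonneg
        (Filter.Eventually.of_forall fun r => mul_nonneg (weight_nonneg T r) (sq_nonneg _))
        (hint.const_mul _).integrableOn ?_
      filter_upwards [ae_restrict_mem measurableSet_Iio] with r hr
      have := mul_le_mul_of_nonneg_left (ih r ((le_of_lt hr).trans hs)) (weight_nonneg (G := G) T r)
      linarith
    rw [integral_const_mul, setIntegral_mul_exp hw] at hb
    have h2 : 0 ≤ M * (1 / 2) ^ n := by positivity
    rw [pow_succ]
    linarith

/-- Take square roots and bound the exponential by its value at T; the rate √(1/2) is then uniform
on [0, T]. -/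
theorem picard_dist_le (hG : IsIntegrand A G) (hΔ : ∀ t, G t ∘L Delta 𝔥 𝔨 = 0)
    {F J : ℕ → ℝ≥0 → InitFock 𝔥 𝔨 →L[ℂ] InitFock 𝔥 𝔨} (hFa : ∀ n, IsVacAdapted A (F n))
    (hFb : ∀ n, LocBdd (F n)) (hJ : ∀ n, IsQSIntegral A (fun s => G s ∘L ampl (F n s)) (J n))
    (hFs : ∀ n s, F (n + 1) s = X s + J n s) (T : ℝ≥0) : ∃ C : ℝ, ∀ s ≤ T, ∀ n,
      dist (F n s) (F (n + 1) s) ≤ C * √(1 / 2) ^ n := by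
  obtain ⟨M, hM0, hM⟩ := picard_step_sq_le hG hΔ hFa hFb hJ hFs T
  refine ⟨√(M * Real.exp (∫ r in Set.Iio T, weight G T r ∂leb)), fun s hs n => ?_⟩
  rw [dist_eq_norm, norm_sub_rev]
  refine (sq_le_sq₀ (norm_nonneg _) (by positivity)).1 ((hM n s hs).trans ?_)
  rw [mul_pow, Real.sq_sqrt (by positivity), ← pow_mul, mul_comm n 2, pow_mul,
    Real.sq_sqrt (by norm_num), mul_right_comm]
  gcongr
  · exact Filter.Eventually.of_forall (weight_nonneg T)
  · exact (hG.integrable_weight T).integrableOn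

/-- This passes the limit through the integral: geometric convergence, uniform on [0, t], is
inserted into the quadratic estimate. -/
theorem IsQSIntegral.tendsto (hG : IsIntegrand A G) (hΔ : ∀ t, G t ∘L Delta 𝔥 𝔨 = 0)
    {F J : ℕ → ℝ≥0 → InitFock 𝔥 𝔨 →L[ℂ] InitFock 𝔥 𝔨} (hFa : ∀ n, IsVacAdapted A (F n))
    (hFb : ∀ n, LocBdd (F n)) (hJ : ∀ n, IsQSIntegral A (fun s => G s ∘L ampl (F n s)) (J n))
    (hZa : IsVacAdapted A Z) (hZb : LocBdd Z)
    (hY : IsQSIntegral A (fun s => G s ∘L ampl (Z s)) Y) {r : ℝ} (hr0 : 0 ≤ r) (hr1 : r < 1)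
    (t : ℝ≥0) (hdist : ∃ C : ℝ, ∀ s ≤ t, ∀ n, ‖F n s - Z s‖ ≤ C * r ^ n) :
    Filter.Tendsto (fun n => J n t) Filter.atTop (nhds (Y t)) := by
  obtain ⟨C, hC⟩ := hdist
  have hw := hG.integrable_weight t
  set W := ∫ s in Set.Iio t, weight G t s ∂leb
  have hest : ∀ n, ‖J n t - Y t‖ ^ 2 ≤
      1 / 2 * (W * (C * r ^ n) ^ 2) := by
    intro n
    refine ((hJ _).norm_sub_sq_le hG hΔ (hFa n) (hFb n) hZa hZb hY le_rfl).trans ?_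
    refine mul_le_mul_of_nonneg_left ?_ (by norm_num)
    rw [← integral_mul_const]
    refine integral_mono_of_nonneg
      (Filter.Eventually.of_forall fun q => mul_nonneg (weight_nonneg t q) (sq_nonneg _))
      (hw.mul_const _).integrableOn ?_
    filter_upwards [ae_restrict_mem measurableSet_Iio] with q hq
    exact mul_le_mul_of_nonneg_left
      (pow_le_pow_left₀ (norm_nonneg _) (hC q (le_of_lt hq) n) 2) (weight_nonneg t q)
  have hz : Filter.Tendsto (fun n : ℕ => 1 / 2 * (W * (C * r ^ n) ^ 2)) Filter.atTop
      (nhds 0) := by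
    have h1 := tendsto_pow_atTop_nhds_zero_of_lt_one hr0 hr1
    have h2 := ((((h1.const_mul C).pow 2).const_mul W).const_mul (1 / 2))
    simpa using h2
  have h3 := squeeze_zero (fun n => sq_nonneg _) hest hz
  have h4 := (Real.continuous_sqrt.tendsto 0).comp h3
  rw [Real.sqrt_zero] at h4
  refine tendsto_iff_norm_sub_tendsto_zero.2 (h4.congr fun n => ?_)
  exact Real.sqrt_sq (norm_nonneg _)

/-- Existence of a solution, by Picard iteration. -/
theorem exists_isSolution (hG : IsIntegrand A G) (hΔ : ∀ t, G t ∘L Delta 𝔥 𝔨 = 0)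
    (hX : IsVacAdapted A X) (hXb : LocBdd X) : ∃ Z, IsSolution A G X Z := by
  obtain ⟨F, J, hFa, hFb, hJ, hF0, hFs⟩ := exists_picard_sequence hG hΔ hX hXb
  have hgeo := picard_dist_le hG hΔ hFa hFb hJ hFs
  have hr1 : √(1 / 2 : ℝ) < 1 := by
    rw [Real.sqrt_lt' one_pos]; norm_num
  have hlim : ∀ t, ∃ L, Filter.Tendsto (fun n => F n t) Filter.atTop (nhds L) := fun t => by
    obtain ⟨C, hC⟩ := hgeo t
    exact cauchySeq_tendsto_of_complete (cauchySeq_of_le_geometric _ C hr1 (hC t le_rfl))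
  choose Z hZ using hlim
  have hZa : IsVacAdapted A Z := isVacAdapted_of_tendsto hFa hZ
  -- Summing the geometric tail keeps the rate uniform on [0, T]. This gives local boundedness of
  -- the limit, through n = 0, and convergence of the integrals.
  have hZdist : ∀ T : ℝ≥0, ∃ C : ℝ, ∀ s ≤ T, ∀ n, ‖F n s - Z s‖ ≤ C * √(1 / 2) ^ n := by
    intro T
    obtain ⟨C, hC⟩ := hgeo T
    refine ⟨C / (1 - √(1 / 2)), fun s hs n => ?_⟩
    rw [← dist_eq_norm]
    refine (dist_le_of_le_geometric_of_tendsto _ _ hr1 (hC s hs) (hZ s) n).trans_eq ?_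
    ring
  have hZb : LocBdd Z := by
    intro T
    obtain ⟨C, hC⟩ := hZdist T
    obtain ⟨D, hD⟩ := hXb T
    refine ⟨D + C, fun s hs => ?_⟩
    have h0 := hC s hs 0
    have h1 : ‖Z s‖ ≤ ‖X s‖ + ‖X s - Z s‖ := norm_le_norm_add_norm_sub _ _
    rw [hF0, pow_zero, mul_one] at h0
    linarith [hD s hs]
  obtain ⟨Y, hY⟩ := (hG.comp_ampl hΔ hZa hZb).exists_isQSIntegral fun s =>
    comp_ampl_comp_Delta (hΔ s) _
  refine ⟨Z, hZa, Y, hY, fun t => ?_⟩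
  have hJt := IsQSIntegral.tendsto hG hΔ hFa hFb hJ hZa hZb hY (Real.sqrt_nonneg _) hr1 t
    (hZdist t)
  -- Both sides are limits of F_{n+1}(t) = X_t + J_n(t), hence the index shift.
  exact tendsto_nhds_unique ((hZ t).comp (Filter.tendsto_add_atTop_nat 1))
    ((hJt.const_add (X t)).congr fun n => (hFs n t).symm)

end Solution

end VacQSDE

end

theorem theorem3p4 {𝔥 𝔨 : Type*}
    [NormedAddCommGroup 𝔥] [InnerProductSpace ℂ 𝔥] [CompleteSpace 𝔥]
    [TopologicalSpace.SeparableSpace 𝔥]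
    [NormedAddCommGroup 𝔨] [InnerProductSpace ℂ 𝔨] [CompleteSpace 𝔨]
    [TopologicalSpace.SeparableSpace 𝔨]
    (A : VonNeumannAlgebra 𝔥)
    (G : ℝ≥0 → VacQSDE.HatInitFock 𝔥 𝔨 →L[ℂ] VacQSDE.HatInitFock 𝔥 𝔨)
    (hG : VacQSDE.IsIntegrand A G)
    (hGΔ : ∀ t, G t ∘L VacQSDE.Delta 𝔥 𝔨 = 0)
    (X : ℝ≥0 → VacQSDE.InitFock 𝔥 𝔨 →L[ℂ] VacQSDE.InitFock 𝔥 𝔨)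
    (hX : VacQSDE.IsVacAdapted A X)
    (hXbdd : ∀ t : ℝ≥0, ∃ C : ℝ, ∀ s ≤ t, ‖X s‖ ≤ C) :
    (∃! Z : ℝ≥0 → VacQSDE.InitFock 𝔥 𝔨 →L[ℂ] VacQSDE.InitFock 𝔥 𝔨,
      VacQSDE.IsSolution A G X Z) ∧
    ∀ Z : ℝ≥0 → VacQSDE.InitFock 𝔥 𝔨 →L[ℂ] VacQSDE.InitFock 𝔥 𝔨,
      VacQSDE.IsSolution A G X Z →
        (∀ t : ℝ≥0, VacQSDE.locNorm ∞ t Z ≤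
          ENNReal.ofReal (Real.sqrt 2) * VacQSDE.locNorm ∞ t X *
            ENNReal.ofReal (Real.exp
              (2 * (VacQSDE.locNorm 2 t fun s => VacQSDE.blockL (G s)).toReal ^ 2 +
                2 * (VacQSDE.locNorm 1 t fun s => VacQSDE.blockK (G s)).toReal ^ 2))) ∧
        (Continuous Z ↔ Continuous X) := by
  refine ⟨?_, fun Z hZ => ⟨hZ.locNorm_le hG hGΔ hXbdd, hZ.continuous_iff hGΔ⟩⟩
  obtain ⟨Z, hZ⟩ := VacQSDE.exists_isSolution hG hGΔ hX hXbdd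
  exact ⟨Z, hZ, fun Z' hZ' => hZ'.unique hG hGΔ hXbdd hZ⟩
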